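/- Let $\mathbb N=\{1,2,\dots\}$, $[n]=\{1,\dots,n\}$; let $\mathcal P_n$ and $\mathcal P_\infty$ be the sets of partitions of $[n]$ and of $\mathbb N$, let $\mathbf 1$ be the partition with a single block and $\mathcal P_n^*=\mathcal P_n\setminus\{\mathbf 1\}$. Write $\pi_{|n}$ for the restriction of $\pi$ to $[n]$. Equip $\mathcal P_\infty$ with the distance $d(\pi,\pi')=1/\sup\{n:\pi_{|n}=\pi'_{|n}\}$ and its Borel $\sigma$-algebra. For $\pi\in\mathcal P_\infty$, with blocks $\pi_1,\pi_2,\dots$ listed in increasing order of their least elements, and partitions $\pi^{(1)},\pi^{(2)},\dots\in\mathcal P_\infty$, let $\mathrm{FRAG}(\pi,\pi^{(\cdot)})$ be the partition obtained by splitting each block $\pi_i$ according to $\pi^{(i)}$. Let $(\Pi(t),\,t\in[0,1))$ be a standard (time-inhomogeneous) exchangeable fragmentation, i.e. a Markov process in $\mathcal P_\infty$, continuous in probability and with right-continuous paths, such that $\Pi(0)=\mathbf 1$ a.s. and such that for all $0\le s\le t<1$ there is an exchangeable probability $\mathbb P_{s,t}$ on $\mathcal P_\infty$ for which the conditional law of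 $\Pi(t)$ given $(\Pi(u))_{u\le s}$ is that of $\mathrm{FRAG}(\Pi(s),\pi^{(\cdot)})$ with $\pi^{(\cdot)}$ i.i.d. of law $\mathbb P_{s,t}$, independent of $(\Pi(u))_{u\le s}$. Let $\tau_n$ be the time of the first jump of $\Pi_{|n}$ in $[0,1)$ ($\tau_n=1$ if there is none), and assume that for every $n\ge 2$: - $\overline\lambda_n(t):=\mathbb P(\tau_n\ge t)>0$ for all $t\in[0,1)$, and the law of $\tau_n$ has on $[0,1)$ a continuous density $g_n$ with respect to Lebesgue measure; - for every $\pi\in\mathcal P_n^*$, the conditional probability $h^n_\pi(t)=\mathbb P(\Pi_{|n}(t)=\pi\mid\tau_n=t)$ has a version that is continuous in $t\in[0,1)$. For $\pi\in\mathcal P_n^*$ and $t\in[0,1)$ define the instantaneous jump rate from $\mathbf 1$ to $\pi$ by $q_{\pi,t}=h^n_\pi(t)\,g_n(t)/\overline\lambda_n(t)$, and put $Q_{\infty,\pi}=\{\pi'\in\mathcal P_\infty:\pi'_{|n}=\pi\}$. Then: 1. For all $t\in[0,1)$, $n\in\mathbb N$ and $\pi\in\mathcal P_n^*$, $$q_{\pi,t}=\lim_{s\downarrow0}\frac1s\,\mathbb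 P\big(\Pi_{|n}(\tau_n)=\pi,\ \tau_n\in[t,t+s]\ \big|\ \tau_n\ge t\big).$$ 2. For each $t\in[0,1)$ there exists a unique measure $\mu_t$ on $\mathcal P_\infty$ such that $\mu_t(\{\mathbf 1\})=0$ and $\mu_t(Q_{\infty,\pi})=q_{\pi,t}$ for all $n\in\mathbb N$ and $\pi\in\mathcal P_n^*$. 3. The family $(\mu_t)_{t\in[0,1)}$ characterizes the law of the fragmentation: two fragmentations satisfying the above assumptions (possibly defined on different probability spaces) have the same law, on the product $\sigma$-algebra of $\mathcal P_\infty^{[0,1)}$, if and only if their families of measures coincide. -/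

import Mathlib

open MeasureTheory ProbabilityTheory Filter Set
open scoped Topology ENNReal

noncomputable section

namespace InhomFrag

/-! Partitions are encoded by their equivalence relations: a partition of the countable ground set is
a `Setoid ℕ` (the positive integer `k` is represented by `k - 1`), and a partition of
`[n] = {1, …, n}` is a `Setoid (Fin n)`.  The partition with a single block is `⊤`. -/

/-- The restriction `π_{|n}` of a partition of the ground set to its first `n` elements. -/
def restr (n : ℕ) (π : Setoid ℕ) : Setoid (Fin n) := Setoid.comap Fin.val π

/-- The σ-algebra generated by the restriction maps, i.e. the Borel σ-algebra of `partDist`. -/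
instance instMeasurableSpacePartition : MeasurableSpace (Setoid ℕ) :=
  ⨆ n : ℕ, MeasurableSpace.comap (restr n) ⊤

open Classical in
/-- The distance `d(π, ρ) = 1 / sup {n | π_{|n} = ρ_{|n}}`, which is `0` when `π = ρ`. -/
def partDist (π ρ : Setoid ℕ) : ℝ :=
  if π = ρ then 0 else 1 / ((sSup {n : ℕ | restr n π = restr n ρ} : ℕ) : ℝ)

theorem restr_eq_mono {π ρ : Setoid ℕ} {m n : ℕ} (hmn : m ≤ n) (h : restr n π = restr n ρ) :
    restr m π = restr m ρ := by
  ext a b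
  exact Setoid.ext_iff.1 h (Fin.castLE hmn a) (Fin.castLE hmn b)

theorem eq_of_restr_eq {π ρ : Setoid ℕ} (h : ∀ n, restr n π = restr n ρ) : π = ρ := by
  ext a b
  exact Setoid.ext_iff.1 (h (a + b + 1)) ⟨a, by omega⟩ ⟨b, by omega⟩

/-- Closeness for `partDist` is agreement on an initial segment. -/
theorem partDist_lt_iff {π ρ : Setoid ℕ} {n : ℕ} (hn : 1 ≤ n) :
    partDist π ρ < 1 / (n : ℝ) ↔ restr (n + 1) π = restr (n + 1) ρ := by
  have hn' : (0 : ℝ) < n := by exact_mod_cast hn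
  by_cases hπ : π = ρ
  · subst hπ
    simp only [partDist, if_true]
    exact iff_of_true (by positivity) trivial
  · rw [partDist, if_neg hπ]
    have hne : ∃ N, restr N π ≠ restr N ρ := by
      by_contra hcon
      push Not at hcon
      exact hπ (eq_of_restr_eq hcon)
    obtain ⟨N, hN⟩ := hne
    have hbdd : BddAbove {k : ℕ | restr k π = restr k ρ} := by
      refine ⟨N, fun k hk => ?_⟩
      by_contra hlt
      exact hN (restr_eq_mono (by omega) hk)
    have h1 : (1 : ℕ) ∈ {k : ℕ | restr k π = restr k ρ} := by
      refine Setoid.ext fun a b => ?_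
      have : a = b := Subsingleton.elim a b
      subst this
      exact iff_of_true (Setoid.refl' _ _) (Setoid.refl' _ _)
    have hpos : 1 ≤ sSup {k : ℕ | restr k π = restr k ρ} := le_csSup hbdd h1
    have hmem : sSup {k : ℕ | restr k π = restr k ρ} ∈ {k : ℕ | restr k π = restr k ρ} :=
      Nat.sSup_mem ⟨1, h1⟩ hbdd
    have hpos' : (0 : ℝ) < ((sSup {k : ℕ | restr k π = restr k ρ} : ℕ) : ℝ) := by
      exact_mod_cast hpos
    rw [one_div_lt_one_div hpos' hn', Nat.cast_lt]
    exact ⟨fun h => restr_eq_mono h hmem, fun h => le_csSup hbdd h⟩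

/-- The smallest element of the block of `π` that contains `x`. -/
def blockMin (π : Setoid ℕ) (x : ℕ) : ℕ := sInf {y | π y x}

/-- The rank (counted from `0`) of the block of `π` containing `x`, when the blocks are listed in
increasing order of their smallest elements: the number of block minima below that of `x`. -/
def blockIndex (π : Setoid ℕ) (x : ℕ) : ℕ :=
  ((Finset.range (blockMin π x)).filter (fun m => blockMin π m = m)).card

theorem blockMin_eq {π : Setoid ℕ} {x y : ℕ} (h : π x y) : blockMin π x = blockMin π y := by
  unfold blockMin
  congr 1
  ext z
  exact ⟨fun hz => π.trans' hz h, fun hz => π.trans' hz (π.symm' h)⟩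

theorem blockIndex_eq {π : Setoid ℕ} {x y : ℕ} (h : π x y) :
    blockIndex π x = blockIndex π y := by
  unfold blockIndex
  rw [blockMin_eq h]

/-- `FRAG(π, ρ⁽·⁾)`: the `i`-th block of `π` is split according to the partition `ρ i`. -/
def frag (π : Setoid ℕ) (ρ : ℕ → Setoid ℕ) : Setoid ℕ where
  r x y := π x y ∧ ρ (blockIndex π x) x y
  iseqv :=
    { refl := fun x => ⟨π.refl' x, (ρ _).refl' x⟩
      symm := fun {x y} h =>
        ⟨π.symm' h.1, by rw [← blockIndex_eq h.1]; exact (ρ _).symm' h.2⟩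
      trans := fun {x y z} h k =>
        ⟨π.trans' h.1 k.1,
          (ρ _).trans' h.2 (by rw [blockIndex_eq h.1]; exact k.2)⟩ }

theorem measurableSet_rel (x y : ℕ) : MeasurableSet {ρ : Setoid ℕ | ρ x y} := by
  have hle : MeasurableSpace.comap (restr (x + y + 1)) ⊤ ≤ instMeasurableSpacePartition :=
    le_iSup (fun n : ℕ => MeasurableSpace.comap (restr n) ⊤) (x + y + 1)
  refine hle _ ⟨{σ | σ ⟨x, by omega⟩ ⟨y, by omega⟩}, trivial, ?_⟩
  rfl

/-- A map into partitions is measurable as soon as all events "`x` and `y` are in the same block"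
are measurable. -/
theorem measurable_of_rel {α : Type*} [MeasurableSpace α] {f : α → Setoid ℕ}
    (hf : ∀ x y, MeasurableSet {a | f a x y}) : Measurable f := by
  refine measurable_iff_le_map.2 (iSup_le fun n => ?_)
  rintro _ ⟨S, -, rfl⟩
  change MeasurableSet (f ⁻¹' (restr n ⁻¹' S))
  have key : ∀ σ : Setoid (Fin n), MeasurableSet {a | restr n (f a) = σ} := by
    intro σ
    have : {a | restr n (f a) = σ} = ⋂ i : Fin n, ⋂ j : Fin n, {a | f a i j ↔ σ i j} := by
      ext a
      simp only [mem_ofPred_eq, mem_iInter, Setoid.ext_iff]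
      rfl
    rw [this]
    refine MeasurableSet.iInter fun i => MeasurableSet.iInter fun j => ?_
    exact MeasurableSet.iff (hf i j) (MeasurableSet.const _)
  have hfin : Finite (Setoid (Fin n)) :=
    Finite.of_injective (fun σ : Setoid (Fin n) => fun i j => σ i j)
      (fun σ τ h => Setoid.ext fun i j => by
        have := congrFun (congrFun h i) j
        exact iff_of_eq this)
  have : f ⁻¹' (restr n ⁻¹' S) = ⋃ σ ∈ S, {a | restr n (f a) = σ} := by
    ext a
    simp
  rw [this]
  exact MeasurableSet.biUnion (Set.to_countable S) fun σ _ => key σ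

theorem measurable_frag (π : Setoid ℕ) : Measurable (frag π) := by
  refine measurable_of_rel fun x y => ?_
  have : {ρ : ℕ → Setoid ℕ | (frag π ρ) x y} =
      {_ρ | π x y} ∩ (fun ρ : ℕ → Setoid ℕ => ρ (blockIndex π x)) ⁻¹' {τ | τ x y} := rfl
  rw [this]
  exact (MeasurableSet.const _).inter (measurable_pi_apply _ (measurableSet_rel x y))

/-- The kernel `ν`-`FRAG(π, ·)`: the law of `FRAG(π, ρ⁽·⁾)` for an i.i.d. sequence `ρ⁽·⁾` with
law `ν`. -/
def fragLaw (ν : Measure (Setoid ℕ)) [IsProbabilityMeasure ν] (π : Setoid ℕ) :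
    Measure (Setoid ℕ) :=
  (Measure.infinitePi fun _ : ℕ => ν).map (frag π)

/-- Invariance under the action of the permutations of the ground set with finite support. -/
def Exchangeable (ν : Measure (Setoid ℕ)) : Prop :=
  ∀ σ : Equiv.Perm ℕ, {x | σ x ≠ x}.Finite → ν.map (fun π => Setoid.comap σ π) = ν

variable {Ω : Type*} [MeasurableSpace Ω]

/-- The σ-algebra generated by the process up to time `s`. -/
abbrev past (X : ℝ → Ω → Setoid ℕ) (s : ℝ) : MeasurableSpace Ω :=
  ⨆ u ∈ Icc (0 : ℝ) s, MeasurableSpace.comap (X u) instMeasurableSpacePartition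

/-- `(X t, 0 ≤ t < 1)` is a (possibly time-inhomogeneous) exchangeable fragmentation process: a
Markov process, continuous in probability, whose transition from time `s` to time `t` is
`ν`-`FRAG` for an exchangeable probability `ν` depending on `s` and `t`.  As usual its paths are
taken right-continuous (left limits then exist almost surely, since the partitions get finer).
Values of `X` at times outside `[0, 1)` play no role. -/
structure IsFragmentation (P : Measure Ω) (X : ℝ → Ω → Setoid ℕ) : Prop where
  measurable : ∀ t ∈ Ico (0 : ℝ) 1, Measurable (X t)
  right_continuous : ∀ ω, ∀ t ∈ Ico (0 : ℝ) 1,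
    Tendsto (fun u => partDist (X u ω) (X t ω)) (𝓝[>] t) (𝓝 0)
  continuous_in_probability : ∀ t ∈ Ico (0 : ℝ) 1, ∀ ε > 0,
    Tendsto (fun u => P {ω | ε ≤ partDist (X u ω) (X t ω)}) (𝓝[Ico 0 1] t) (𝓝 0)
  semigroup : ∀ s t : ℝ, 0 ≤ s → s ≤ t → t < 1 →
    ∃ (ν : Measure (Setoid ℕ)) (_ : IsProbabilityMeasure ν), Exchangeable ν ∧
      ∀ B : Set (Setoid ℕ), MeasurableSet B →
        P[(X t ⁻¹' B).indicator (fun _ => (1 : ℝ)) | past X s]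
          =ᵐ[P] fun ω => (fragLaw ν (X s ω)).real B

/-- The fragmentation is standard: it starts from the partition with a single block. -/
def IsStandard (P : Measure Ω) (X : ℝ → Ω → Setoid ℕ) : Prop :=
  ∀ᵐ ω ∂P, X 0 ω = ⊤

/-- The first jump time `τ_n` of the restricted process started from the one-block partition, with
value `1` when there is no jump during `[0, 1)`. -/
def firstJump (X : ℝ → Ω → Setoid ℕ) (n : ℕ) (ω : Ω) : ℝ :=
  sInf (insert 1 {t | t ∈ Ico (0 : ℝ) 1 ∧ restr n (X t ω) ≠ ⊤})

/-- The law `λ_n` of `τ_n`. -/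
def jumpLaw (P : Measure Ω) (X : ℝ → Ω → Setoid ℕ) (n : ℕ) : Measure ℝ :=
  P.map (firstJump X n)

/-- The tail `P(τ_n ≥ t)`. -/
def jumpTail (P : Measure Ω) (X : ℝ → Ω → Setoid ℕ) (n : ℕ) (t : ℝ) : ℝ :=
  P.real {ω | t ≤ firstJump X n ω}

/-- The regularity assumption on the first jumps: for all `n ≥ 2` (the restriction to one point
never jumps), `P(τ_n ≥ t) > 0` for `t ∈ [0, 1)`, the law of `τ_n` has on `[0, 1)` the continuous
density `g n`, and for `π ≠ ⊤` the continuous function `h n π` is a version of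
`t ↦ P(Π_{|n}(t) = π | τ_n = t)` on `[0, 1)`. -/
structure HasRegularJumps (P : Measure Ω) (X : ℝ → Ω → Setoid ℕ) (g : ℕ → ℝ → ℝ)
    (h : (n : ℕ) → Setoid (Fin n) → ℝ → ℝ) : Prop where
  tail_pos : ∀ n, 2 ≤ n → ∀ t ∈ Ico (0 : ℝ) 1, 0 < jumpTail P X n t
  g_nonneg : ∀ n, 2 ≤ n → ∀ t ∈ Ico (0 : ℝ) 1, 0 ≤ g n t
  g_continuous : ∀ n, 2 ≤ n → ContinuousOn (g n) (Ico 0 1)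
  g_density : ∀ n, 2 ≤ n → (jumpLaw P X n).restrict (Ico 0 1) =
    (volume.restrict (Ico 0 1)).withDensity fun t => ENNReal.ofReal (g n t)
  h_nonneg : ∀ n, 2 ≤ n → ∀ π : Setoid (Fin n), π ≠ ⊤ → ∀ t ∈ Ico (0 : ℝ) 1, 0 ≤ h n π t
  h_continuous : ∀ n, 2 ≤ n → ∀ π : Setoid (Fin n), π ≠ ⊤ → ContinuousOn (h n π) (Ico 0 1)
  h_conditional : ∀ n, 2 ≤ n → ∀ π : Setoid (Fin n), π ≠ ⊤ →
    ∀ A : Set ℝ, MeasurableSet A → A ⊆ Ico 0 1 →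
      P {ω | firstJump X n ω ∈ A ∧ restr n (X (firstJump X n ω) ω) = π} =
        ∫⁻ t in A, ENNReal.ofReal (h n π t) ∂(jumpLaw P X n)

/-- The instantaneous jump rate `q_{π,t} = h^n_π(t) f_n(t)` with `f_n(t) = g_n(t) / P(τ_n ≥ t)`. -/
def jumpRate (P : Measure Ω) (X : ℝ → Ω → Setoid ℕ) (g : ℕ → ℝ → ℝ)
    (h : (n : ℕ) → Setoid (Fin n) → ℝ → ℝ) (n : ℕ) (π : Setoid (Fin n)) (t : ℝ) : ℝ :=
  h n π t * (g n t / jumpTail P X n t)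

/-- The set `Q_{∞,π}` of the partitions of the whole ground set whose restriction is `π`. -/
def cylinder (n : ℕ) (π : Setoid (Fin n)) : Set (Setoid ℕ) := {ρ | restr n ρ = π}

/-- `μ` does not charge the one-block partition and gives mass `q_{π,t}` to `Q_{∞,π}` for all `n`
and all partitions `π` of `[n]` with at least two blocks. -/
def IsJumpMeasure (P : Measure Ω) (X : ℝ → Ω → Setoid ℕ) (g : ℕ → ℝ → ℝ)
    (h : (n : ℕ) → Setoid (Fin n) → ℝ → ℝ) (t : ℝ) (μ : Measure (Setoid ℕ)) : Prop :=
  (∀ (n : ℕ) (π : Setoid (Fin n)), π ≠ ⊤ →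
    μ (cylinder n π) = ENNReal.ofReal (jumpRate P X g h n π t)) ∧ μ {⊤} = 0

/-- The law of the process `(X t, 0 ≤ t < 1)`, on the product σ-algebra of the path space. -/
def processLaw (P : Measure Ω) (X : ℝ → Ω → Setoid ℕ) : Measure (Ico (0 : ℝ) 1 → Setoid ℕ) :=
  P.map fun ω t => X t ω

end InhomFrag

end

/-! The restriction of `frag x ρ` to `[n]` depends on `x` only through `restr n x` and uses only `ρ
0, …, ρ (n - 1)`. Hence the restricted process is a Markov chain on a finite set, and since `frag ⊤
ρ = ρ 0`, its transition from the one-block state between times `s` and `t` is the image on `[n]` of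
`transitionLaw hX s t`. The positive tails make this image computable from two-time probabilities
(`transitionLaw_cylinder`).

The central fact is `tendsto_transitionLaw_cylinder`: the rate of `π` at time `t` is the right
derivative at `0` of `s ↦ (transitionLaw hX t (t + s)).real (cylinder n π)`. The density gives the
derivative of the probability that the first jump falls in `[t, t + s]` and lands on `π`. Replacing
the state just after that jump by the state at time `t + s` costs at most the probability of two
jumps in the interval, which is of order `s ^ 2`, hence negligible after division by `s`, by
`measure_firstJump_then_jump_le`. The limit that defines the rates needs only the density.

Existence of the measure: the rescaled measures `s⁻¹ • transitionLaw hX t (t + s)` converge on every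
cylinder away from `⊤`, so the limit is additive and the consistency in `n` of the rates is
automatic. These cylinders form a ring of clopen sets of a compact space; countable covers inside
the ring reduce to finite ones, and Carathéodory's extension applies (`exists_measure_of_tendsto`).
Uniqueness is a π-system argument (`measure_ext_of_cylinder`).

Characterization: if two processes have the same rates, the `ℓ¹` distance on `[n]` between their
transition laws from `s` to `u` is continuous in `u`, vanishes at `u = s`, and by Chapman–Kolmogorov
has nonpositive upper right derivative; so it vanishes (`cylinderDist_transitionLaw_eq_zero`). The
Markov property then gives equal finite-dimensional laws on each `[n]`, hence equal laws.
Conversely, the law determines the transition probabilities and thus their derivatives, the rates.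
-/

namespace InhomFrag

set_option linter.unusedSectionVars false

/-! ### Restrictions of partitions and their behaviour under fragmentation -/

section Partitions

instance finite_setoid_fin (n : ℕ) : Finite (Setoid (Fin n)) :=
  Finite.of_injective (fun σ : Setoid (Fin n) => fun i j => σ i j)
    (fun _ _ h => Setoid.ext fun i j => iff_of_eq (congrFun (congrFun h i) j))

noncomputable instance fintype_setoid_fin (n : ℕ) : Fintype (Setoid (Fin n)) :=
  Fintype.ofFinite _

instance measurableSpace_setoid_fin (n : ℕ) : MeasurableSpace (Setoid (Fin n)) := ⊤

instance discreteMeasurableSpace_setoid_fin (n : ℕ) : DiscreteMeasurableSpace (Setoid (Fin n)) :=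
  ⟨fun _ => trivial⟩

theorem measurable_restr (n : ℕ) : Measurable (restr n) :=
  measurable_iff_comap_le.2 (le_iSup (fun n : ℕ => MeasurableSpace.comap (restr n) ⊤) n)

theorem measurableSet_cylinder (n : ℕ) (π : Setoid (Fin n)) : MeasurableSet (cylinder n π) :=
  measurable_restr n (MeasurableSet.singleton π)

theorem restr_top (n : ℕ) : restr n ⊤ = ⊤ := rfl

theorem restr_eq_iff {n : ℕ} {x y : Setoid ℕ} :
    restr n x = restr n y ↔ ∀ i < n, ∀ j < n, (x i j ↔ y i j) :=
  ⟨fun h i hi j hj => Setoid.ext_iff.1 h ⟨i, hi⟩ ⟨j, hj⟩,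
    fun h => Setoid.ext fun i j => h i i.2 j j.2⟩

theorem subsingleton_setoid_fin {n : ℕ} (hn : n < 2) (π : Setoid (Fin n)) : π = ⊤ := by
  ext a b
  have : a = b := by ext; omega
  subst this
  exact iff_of_true (π.refl' a) trivial

theorem two_le_of_ne_top {n : ℕ} {π : Setoid (Fin n)} (hπ : π ≠ ⊤) : 2 ≤ n := by
  by_contra h
  exact hπ (subsingleton_setoid_fin (by omega) π)

theorem restr_surjective (n : ℕ) : Function.Surjective (restr n) := by
  intro σ
  -- Every element outside `[n]` forms a singleton block.
  refine ⟨⟨fun x y => x = y ∨ ∃ (hx : x < n) (hy : y < n), σ ⟨x, hx⟩ ⟨y, hy⟩, ?_, ?_, ?_⟩, ?_⟩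
  · exact fun x => Or.inl rfl
  · rintro x y (rfl | ⟨hx, hy, h⟩)
    · exact Or.inl rfl
    · exact Or.inr ⟨hy, hx, σ.symm' h⟩
  · rintro x y z (rfl | ⟨hx, hy, h⟩) (rfl | ⟨hy', hz, k⟩)
    · exact Or.inl rfl
    · exact Or.inr ⟨hy', hz, k⟩
    · exact Or.inr ⟨hx, hy, h⟩
    · exact Or.inr ⟨hx, hz, σ.trans' h k⟩
  · ext i j
    constructor
    · rintro (h | ⟨hx, hy, h⟩)
      · rw [Fin.ext h]
      · exact h
    · exact fun h => Or.inr ⟨i.2, j.2, h⟩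

/-- A partition of the whole ground set with prescribed restriction. -/
noncomputable def liftPartition {n : ℕ} (σ : Setoid (Fin n)) : Setoid ℕ :=
  Function.surjInv (restr_surjective n) σ

theorem restr_liftPartition {n : ℕ} (σ : Setoid (Fin n)) : restr n (liftPartition σ) = σ :=
  Function.surjInv_eq (restr_surjective n) σ

/-- The restriction of a partition of `[n]` to `[m]`. -/
def restrFin {m n : ℕ} (hmn : m ≤ n) (σ : Setoid (Fin n)) : Setoid (Fin m) :=
  Setoid.comap (Fin.castLE hmn) σ

theorem blockMin_le (π : Setoid ℕ) (x : ℕ) : blockMin π x ≤ x := Nat.sInf_le (π.refl' x)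

theorem blockIndex_le (π : Setoid ℕ) (x : ℕ) : blockIndex π x ≤ x := by
  unfold blockIndex
  refine (Finset.card_filter_le _ _).trans ?_
  rw [Finset.card_range]
  exact blockMin_le π x

theorem blockMin_rel (π : Setoid ℕ) (x : ℕ) : π (blockMin π x) x :=
  Nat.sInf_mem (s := {y | π y x}) ⟨x, π.refl' x⟩

theorem blockMin_congr {n : ℕ} {x y : Setoid ℕ} (h : restr n x = restr n y) {i : ℕ} (hi : i < n) :
    blockMin x i = blockMin y i := by
  rw [restr_eq_iff] at h
  refine le_antisymm (Nat.sInf_le ?_) (Nat.sInf_le ?_)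
  · exact (h _ ((blockMin_le y i).trans_lt hi) _ hi).2 (blockMin_rel y i)
  · exact (h _ ((blockMin_le x i).trans_lt hi) _ hi).1 (blockMin_rel x i)

theorem blockIndex_congr {n : ℕ} {x y : Setoid ℕ} (h : restr n x = restr n y) {i : ℕ}
    (hi : i < n) : blockIndex x i = blockIndex y i := by
  unfold blockIndex
  rw [blockMin_congr h hi]
  congr 1
  refine Finset.filter_congr fun m hm => ?_
  rw [blockMin_congr h (((Finset.mem_range.1 hm).trans_le (blockMin_le y i)).trans hi)]

theorem frag_rel {π : Setoid ℕ} {ρ : ℕ → Setoid ℕ} {x y : ℕ} :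
    frag π ρ x y ↔ π x y ∧ ρ (blockIndex π x) x y := Iff.rfl

/-- Block minima, and hence block ranks, of elements of `[n]` can be read off the restriction to
`[n]`. This is what makes the restricted process Markov. -/
theorem restr_frag_congr {n : ℕ} {x y : Setoid ℕ} (h : restr n x = restr n y)
    (ρ : ℕ → Setoid ℕ) : restr n (frag x ρ) = restr n (frag y ρ) := by
  rw [restr_eq_iff]
  intro i hi j hj
  rw [frag_rel, frag_rel, blockIndex_congr h hi, restr_eq_iff.1 h i hi j hj]

theorem blockIndex_top (i : ℕ) : blockIndex ⊤ i = 0 := by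
  have : blockMin ⊤ i = 0 := Nat.le_zero.1 (Nat.sInf_le trivial)
  unfold blockIndex
  rw [this]
  rfl

theorem frag_top (ρ : ℕ → Setoid ℕ) : frag ⊤ ρ = ρ 0 := by
  ext i j
  rw [frag_rel, blockIndex_top]
  exact and_iff_right trivial

/-- The block of an element `i < n` has rank at most `i`, so only the first `n` terms of `ρ` can act
on `[n]`. -/
theorem restr_frag_eq_of_restr_eq_top {n : ℕ} {x : Setoid ℕ} {ρ : ℕ → Setoid ℕ}
    (h : ∀ k < n, restr n (ρ k) = ⊤) : restr n (frag x ρ) = restr n x := by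
  rw [restr_eq_iff]
  intro i hi j hj
  rw [frag_rel, and_iff_left_iff_imp]
  intro _
  have := h (blockIndex x i) ((blockIndex_le x i).trans_lt hi)
  exact (Setoid.ext_iff.1 this ⟨i, hi⟩ ⟨j, hj⟩).2 trivial

theorem restr_ne_top_of_restr_frag {n : ℕ} {x : Setoid ℕ} {ρ : ℕ → Setoid ℕ}
    (h : restr n (frag x ρ) = ⊤) : restr n x = ⊤ := by
  ext i j
  refine iff_of_true ?_ trivial
  exact ((Setoid.ext_iff.1 h i j).2 trivial).1

/-- The partitions that split the `k`-th block of `x ∩ [n]` as `π` does. -/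
def blockEvent (n : ℕ) (x : Setoid ℕ) (π : Setoid (Fin n)) (k : ℕ) : Set (Setoid ℕ) :=
  restr n ⁻¹' {τ | ∀ i j : Fin n, x i j → blockIndex x i = k → (τ i j ↔ π i j)}

theorem restr_frag_eq_iff {n : ℕ} {x : Setoid ℕ} {π : Setoid (Fin n)} (hπ : π ≤ restr n x)
    (ρ : ℕ → Setoid ℕ) :
    restr n (frag x ρ) = π ↔ ∀ k ∈ Finset.range n, ρ k ∈ blockEvent n x π k := by
  constructor
  · rintro h k - i j hij rfl
    rw [← h]
    exact ⟨fun hr => ⟨hij, hr⟩, fun hr => hr.2⟩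
  · intro h
    ext i j
    have hi : blockIndex x i ∈ Finset.range n :=
      Finset.mem_range.2 ((blockIndex_le x i).trans_lt i.2)
    constructor
    · intro hr
      exact (h _ hi i j hr.1 rfl).1 hr.2
    · intro hr
      exact ⟨hπ hr, (h _ hi i j (hπ hr) rfl).2 hr⟩

end Partitions

/-! ### The fragmentation kernel on cylinders -/

section FragLaw

variable (ν : Measure (Setoid ℕ)) [IsProbabilityMeasure ν]

instance isProbabilityMeasure_fragLaw (x : Setoid ℕ) : IsProbabilityMeasure (fragLaw ν x) :=
  Measure.isProbabilityMeasure_map (measurable_frag x).aemeasurable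

theorem fragLaw_top : fragLaw ν ⊤ = ν := by
  unfold fragLaw
  have : frag ⊤ = fun ρ : ℕ → Setoid ℕ => ρ 0 := funext frag_top
  rw [this]
  exact (measurePreserving_eval_infinitePi (fun _ : ℕ => ν) 0).map_eq

theorem fragLaw_apply (x : Setoid ℕ) {B : Set (Setoid ℕ)} (hB : MeasurableSet B) :
    (fragLaw ν x).real B = (Measure.infinitePi fun _ : ℕ => ν).real (frag x ⁻¹' B) := by
  unfold fragLaw
  rw [map_measureReal_apply (measurable_frag x) hB]

theorem fragLaw_cylinder_congr {n : ℕ} {x y : Setoid ℕ} (h : restr n x = restr n y)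
    (π : Setoid (Fin n)) :
    (fragLaw ν x).real (cylinder n π) = (fragLaw ν y).real (cylinder n π) := by
  rw [fragLaw_apply ν x (measurableSet_cylinder n π), fragLaw_apply ν y (measurableSet_cylinder n π)]
  congr 1
  ext ρ
  simp only [mem_preimage, cylinder, mem_ofPred_eq, restr_frag_congr h ρ]

theorem fragLaw_cylinder_top_eq_zero {n : ℕ} {x : Setoid ℕ} (h : restr n x ≠ ⊤) :
    (fragLaw ν x).real (cylinder n ⊤) = 0 := by
  rw [fragLaw_apply ν x (measurableSet_cylinder n ⊤)]
  have : frag x ⁻¹' cylinder n ⊤ = ∅ := by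
    ext ρ
    simp only [mem_preimage, cylinder, mem_ofPred_eq, mem_empty_iff_false, iff_false]
    exact fun h' => h (restr_ne_top_of_restr_frag h')
  rw [this, measureReal_empty]

/-- For `[n]` to be altered, one of the first `n` splitting partitions must be nontrivial on `[n]`;
a union bound concludes. The bound is uniform in the state `x`, as the two-jump estimate requires.
-/
theorem one_sub_fragLaw_cylinder_le (n : ℕ) (x : Setoid ℕ) :
    1 - (fragLaw ν x).real (cylinder n (restr n x)) ≤ n * (1 - ν.real (cylinder n ⊤)) := by
  have hc := measurableSet_cylinder n (restr n x)
  rw [← probReal_compl_eq_one_sub hc, ← probReal_compl_eq_one_sub (measurableSet_cylinder n ⊤),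
    fragLaw_apply ν x hc.compl]
  have hsub : frag x ⁻¹' (cylinder n (restr n x))ᶜ ⊆
      ⋃ k ∈ Finset.range n, (fun ρ : ℕ → Setoid ℕ => ρ k) ⁻¹' (cylinder n ⊤)ᶜ := by
    intro ρ hρ
    by_contra hcon
    simp only [mem_iUnion, not_exists, mem_preimage, mem_compl_iff, not_not, Finset.mem_range]
      at hcon
    exact hρ (restr_frag_eq_of_restr_eq_top hcon)
  refine (measureReal_mono hsub (measure_ne_top _ _)).trans ((measureReal_biUnion_finset_le _ _).trans ?_)
  refine (Finset.sum_le_card_nsmul _ _ (ν.real (cylinder n ⊤)ᶜ) fun k _ => ?_).trans ?_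
  · rw [← map_measureReal_apply (measurable_pi_apply k) (measurableSet_cylinder n ⊤).compl,
      (measurePreserving_eval_infinitePi (fun _ : ℕ => ν) k).map_eq]
  · rw [Finset.card_range, nsmul_eq_mul]

/-- Different blocks are split by independent partitions, each subject to its own condition. -/
theorem fragLaw_cylinder_eq_prod {n : ℕ} {x : Setoid ℕ} {π : Setoid (Fin n)}
    (hπ : π ≤ restr n x) :
    (fragLaw ν x).real (cylinder n π) = ∏ k ∈ Finset.range n, ν.real (blockEvent n x π k) := by
  rw [fragLaw_apply ν x (measurableSet_cylinder n π)]
  have : frag x ⁻¹' cylinder n π = Set.pi (Finset.range n) (blockEvent n x π) := by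
    ext ρ
    exact restr_frag_eq_iff hπ ρ
  have hm : ∀ k ∈ Finset.range n, MeasurableSet (blockEvent n x π k) :=
    fun k _ => measurable_restr n trivial
  rw [this, measureReal_def, Measure.infinitePi_pi _ hm, ENNReal.toReal_prod]
  rfl

theorem fragLaw_cylinder_eq_zero {n : ℕ} {x : Setoid ℕ} {π : Setoid (Fin n)}
    (hπ : ¬ π ≤ restr n x) : (fragLaw ν x).real (cylinder n π) = 0 := by
  rw [fragLaw_apply ν x (measurableSet_cylinder n π)]
  have : frag x ⁻¹' cylinder n π = ∅ := by
    ext ρ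
    simp only [mem_preimage, cylinder, mem_ofPred_eq, mem_empty_iff_false, iff_false]
    rintro rfl
    exact hπ fun _ _ h => h.1
  rw [this, measureReal_empty]

theorem sum_cylinder_inter {Ω : Type*} [MeasurableSpace Ω] (P : Measure Ω) [IsFiniteMeasure P]
    {n : ℕ} {Y : Ω → Setoid (Fin n)} (hY : Measurable Y) (A : Set Ω) (S : Finset (Setoid (Fin n))) :
    P.real (A ∩ Y ⁻¹' S) = ∑ σ ∈ S, P.real (A ∩ Y ⁻¹' {σ}) := by
  have h1 := sum_measureReal_preimage_singleton (μ := P.restrict A) S (f := Y)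
    (fun y _ => hY (MeasurableSet.singleton y))
  have h2 : ∀ T : Set (Setoid (Fin n)), (P.restrict A).real (Y ⁻¹' T) = P.real (A ∩ Y ⁻¹' T) := by
    intro T
    rw [measureReal_restrict_apply (hY trivial), inter_comm]
  simp only [h2] at h1
  exact h1.symm

theorem sum_cylinder {n : ℕ} (S : Finset (Setoid (Fin n))) :
    ν.real (restr n ⁻¹' S) = ∑ σ ∈ S, ν.real (cylinder n σ) := by
  have := sum_cylinder_inter ν (measurable_restr n) univ S
  simp only [univ_inter] at this
  exact this

theorem sum_cylinder_univ (n : ℕ) : ∑ σ : Setoid (Fin n), ν.real (cylinder n σ) = 1 := by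
  rw [← sum_cylinder ν]
  simp

theorem abs_preimage_restr_sub_le (ν' : Measure (Setoid ℕ)) [IsProbabilityMeasure ν'] {n : ℕ}
    (A : Set (Setoid (Fin n))) :
    |ν.real (restr n ⁻¹' A) - ν'.real (restr n ⁻¹' A)| ≤
      ∑ σ : Setoid (Fin n), |ν.real (cylinder n σ) - ν'.real (cylinder n σ)| := by
  classical
  have h : A = ((Finset.univ.filter (· ∈ A) : Finset (Setoid (Fin n))) : Set (Setoid (Fin n))) := by
    ext; simp
  rw [h, sum_cylinder, sum_cylinder, ← Finset.sum_sub_distrib]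
  refine (Finset.abs_sum_le_sum_abs _ _).trans ?_
  exact Finset.sum_le_sum_of_subset_of_nonneg (Finset.subset_univ _) fun _ _ _ => abs_nonneg _

theorem abs_prod_sub_prod_le {ι : Type*} (s : Finset ι) (a b : ι → ℝ)
    (ha : ∀ i, 0 ≤ a i ∧ a i ≤ 1) (hb : ∀ i, 0 ≤ b i ∧ b i ≤ 1) :
    |∏ i ∈ s, a i - ∏ i ∈ s, b i| ≤ ∑ i ∈ s, |a i - b i| := by
  classical
  induction s using Finset.induction_on with
  | empty => simp
  | insert i s hi ih =>
    rw [Finset.prod_insert hi, Finset.prod_insert hi, Finset.sum_insert hi]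
    have h1 : a i * ∏ j ∈ s, a j - b i * ∏ j ∈ s, b j =
        (a i - b i) * ∏ j ∈ s, a j + b i * (∏ j ∈ s, a j - ∏ j ∈ s, b j) := by ring
    have h2 : |∏ j ∈ s, a j| ≤ 1 := by
      rw [abs_of_nonneg (Finset.prod_nonneg fun j _ => (ha j).1)]
      exact Finset.prod_le_one (fun j _ => (ha j).1) fun j _ => (ha j).2
    have h3 : |b i| ≤ 1 := by
      rw [abs_of_nonneg (hb i).1]
      exact (hb i).2
    rw [h1]
    refine (abs_add_le _ _).trans ?_
    rw [abs_mul, abs_mul]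
    have := mul_le_mul_of_nonneg_left h2 (abs_nonneg (a i - b i))
    have := mul_le_mul_of_nonneg_right h3 (abs_nonneg (∏ j ∈ s, a j - ∏ j ∈ s, b j))
    linarith

/-- Lipschitz dependence of the kernel on the splitting law: both sides are products of `n` factors
in `[0, 1]`, and each pair of factors differs by at most the `ℓ¹` distance on `[n]`. -/
theorem abs_fragLaw_cylinder_sub_le (ν' : Measure (Setoid ℕ)) [IsProbabilityMeasure ν'] {n : ℕ}
    (x : Setoid ℕ) (π : Setoid (Fin n)) :
    |(fragLaw ν x).real (cylinder n π) - (fragLaw ν' x).real (cylinder n π)| ≤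
      n * ∑ σ : Setoid (Fin n), |ν.real (cylinder n σ) - ν'.real (cylinder n σ)| := by
  by_cases hπ : π ≤ restr n x
  · rw [fragLaw_cylinder_eq_prod ν hπ, fragLaw_cylinder_eq_prod ν' hπ]
    refine (abs_prod_sub_prod_le _ _ _ (fun _ => ⟨measureReal_nonneg, measureReal_le_one⟩)
      fun _ => ⟨measureReal_nonneg, measureReal_le_one⟩).trans ?_
    refine (Finset.sum_le_card_nsmul _ _ _ fun k _ => abs_preimage_restr_sub_le ν ν' _).trans ?_
    rw [Finset.card_range, nsmul_eq_mul]
  · rw [fragLaw_cylinder_eq_zero ν hπ, fragLaw_cylinder_eq_zero ν' hπ, sub_self, abs_zero]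
    exact mul_nonneg (Nat.cast_nonneg n) (Finset.sum_nonneg fun _ _ => abs_nonneg _)

end FragLaw

/-! ### The Markov property of the restricted process -/

section Markov

variable {Ω : Type*} [MeasurableSpace Ω] {P : Measure Ω} [IsProbabilityMeasure P]
  {X : ℝ → Ω → Setoid ℕ}

theorem IsFragmentation.past_le (hX : IsFragmentation P X) {s : ℝ} (hs : s < 1) :
    past X s ≤ ‹MeasurableSpace Ω› :=
  iSup₂_le fun u hu => (hX.measurable u ⟨hu.1, hu.2.trans_lt hs⟩).comap_le

theorem measurable_past {u s : ℝ} (hu : 0 ≤ u) (hus : u ≤ s) : Measurable[past X s] (X u) :=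
  measurable_iff_comap_le.2
    (le_iSup₂ (f := fun (u : ℝ) (_ : u ∈ Icc (0 : ℝ) s) =>
      MeasurableSpace.comap (X u) instMeasurableSpacePartition) u ⟨hu, hus⟩)

theorem IsFragmentation.measurableSet_cylinder (hX : IsFragmentation P X) {t : ℝ}
    (ht : t ∈ Ico (0 : ℝ) 1) (n : ℕ) (π : Setoid (Fin n)) :
    MeasurableSet (X t ⁻¹' cylinder n π) :=
  hX.measurable t ht (InhomFrag.measurableSet_cylinder n π)

open Classical in
/-- A law `ν` for which the transition of the fragmentation from `s` to `t` is `ν`-`FRAG`. -/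
noncomputable def transitionLaw (hX : IsFragmentation P X) (s t : ℝ) : Measure (Setoid ℕ) :=
  if h : 0 ≤ s ∧ s ≤ t ∧ t < 1 then (hX.semigroup s t h.1 h.2.1 h.2.2).choose
  -- An arbitrary probability, so that the law is a probability for all `s` and `t`.
  else Measure.dirac ⊤

instance isProbabilityMeasure_transitionLaw (hX : IsFragmentation P X) (s t : ℝ) :
    IsProbabilityMeasure (transitionLaw hX s t) := by
  unfold transitionLaw
  split_ifs with h
  · exact (hX.semigroup s t h.1 h.2.1 h.2.2).choose_spec.choose
  · infer_instance

theorem condExp_transitionLaw (hX : IsFragmentation P X) {s t : ℝ} (hs : 0 ≤ s) (hst : s ≤ t)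
    (ht : t < 1) {B : Set (Setoid ℕ)} (hB : MeasurableSet B) :
    P[(X t ⁻¹' B).indicator (fun _ => (1 : ℝ)) | past X s]
      =ᵐ[P] fun ω => (fragLaw (transitionLaw hX s t) (X s ω)).real B := by
  have h : 0 ≤ s ∧ s ≤ t ∧ t < 1 := ⟨hs, hst, ht⟩
  have heq : transitionLaw hX s t = (hX.semigroup s t h.1 h.2.1 h.2.2).choose := by
    unfold transitionLaw
    rw [dif_pos h]
  have key := (hX.semigroup s t h.1 h.2.1 h.2.2).choose_spec.choose_spec.2 B hB
  have hfun : (fun ω => (fragLaw (transitionLaw hX s t) (X s ω)).real B) =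
      fun ω => (@fragLaw _ (hX.semigroup s t h.1 h.2.1 h.2.2).choose_spec.choose (X s ω)).real B := by
    funext ω
    congr 2
  rw [hfun]
  exact key

/-- The Markov property, on an event of the past on which the restriction to `[n]` is constant. -/
theorem measure_past_inter_cylinder (hX : IsFragmentation P X) {s t : ℝ} (hs : 0 ≤ s)
    (hst : s ≤ t) (ht : t < 1) {A : Set Ω} (hA : MeasurableSet[past X s] A) {n : ℕ} {x : Setoid ℕ}
    (hAx : A ⊆ X s ⁻¹' cylinder n (restr n x)) (π : Setoid (Fin n)) :
    P.real (A ∩ X t ⁻¹' cylinder n π) =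
      P.real A * (fragLaw (transitionLaw hX s t) x).real (cylinder n π) := by
  have hm := hX.past_le (hst.trans_lt ht)
  have hB := measurableSet_cylinder n π
  have hE : MeasurableSet (X t ⁻¹' cylinder n π) := hX.measurable t ⟨hs.trans hst, ht⟩ hB
  have h1 : ∫ ω in A, (P[(X t ⁻¹' cylinder n π).indicator (fun _ => (1 : ℝ)) | past X s]) ω ∂P =
      ∫ ω in A, (X t ⁻¹' cylinder n π).indicator (fun _ => (1 : ℝ)) ω ∂P :=
    setIntegral_condExp hm ((integrable_const 1).indicator hE) hA
  have h2 : ∫ ω in A, (P[(X t ⁻¹' cylinder n π).indicator (fun _ => (1 : ℝ)) | past X s]) ω ∂P =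
      ∫ ω in A, (fragLaw (transitionLaw hX s t) x).real (cylinder n π) ∂P := by
    refine setIntegral_congr_ae (hm A hA) ?_
    filter_upwards [condExp_transitionLaw hX hs hst ht hB] with ω hω hωA
    rw [hω]
    -- On `A` the random state may be replaced by the fixed `x`, as both have the same restriction
    -- to `[n]`.
    exact fragLaw_cylinder_congr _ (hAx hωA) π
  have h3 : ∫ ω in A, (X t ⁻¹' cylinder n π).indicator (fun _ => (1 : ℝ)) ω ∂P =
      P.real (A ∩ X t ⁻¹' cylinder n π) := by
    rw [setIntegral_indicator hE, setIntegral_const, smul_eq_mul, mul_one]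
  have h4 : ∫ ω in A, (fragLaw (transitionLaw hX s t) x).real (cylinder n π) ∂P =
      P.real A * (fragLaw (transitionLaw hX s t) x).real (cylinder n π) := by
    rw [setIntegral_const, smul_eq_mul]
  rw [← h3, ← h1, h2, h4]

theorem measurableSet_past_cylinder {u s : ℝ} (hu : 0 ≤ u) (hus : u ≤ s) (n : ℕ)
    (π : Setoid (Fin n)) : MeasurableSet[past X s] (X u ⁻¹' cylinder n π) :=
  measurable_past hu hus (measurableSet_cylinder n π)

theorem measure_cylinder_top_inter (hX : IsFragmentation P X) {s t : ℝ} (hs : 0 ≤ s)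
    (hst : s ≤ t) (ht : t < 1) {n : ℕ} (π : Setoid (Fin n)) :
    P.real (X s ⁻¹' cylinder n ⊤ ∩ X t ⁻¹' cylinder n π) =
      P.real (X s ⁻¹' cylinder n ⊤) * (transitionLaw hX s t).real (cylinder n π) := by
  have := measure_past_inter_cylinder hX hs hst ht (x := ⊤)
    (measurableSet_past_cylinder (X := X) hs le_rfl n ⊤) Subset.rfl π
  rwa [fragLaw_top] at this

/-- Once the restriction to `[n]` has left the one-block partition, it does not come back. -/
theorem ae_restr_eq_top_of_le (hX : IsFragmentation P X) {s t : ℝ} (hs : 0 ≤ s)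
    (hst : s ≤ t) (ht : t < 1) (n : ℕ) :
    ∀ᵐ ω ∂P, restr n (X t ω) = ⊤ → restr n (X s ω) = ⊤ := by
  have h : ∀ σ : Setoid (Fin n), ∀ᵐ ω ∂P, restr n (X t ω) = ⊤ → restr n (X s ω) = σ → σ = ⊤ := by
    intro σ
    by_cases hσ : σ = ⊤
    · exact Eventually.of_forall fun _ _ _ => hσ
    have h0 : P.real (X s ⁻¹' cylinder n σ ∩ X t ⁻¹' cylinder n ⊤) = 0 := by
      rw [measure_past_inter_cylinder hX hs hst ht (x := liftPartition σ)
        (measurableSet_past_cylinder (X := X) hs le_rfl n σ) (by rw [restr_liftPartition]) ⊤,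
        fragLaw_cylinder_top_eq_zero _ (by rwa [restr_liftPartition]), mul_zero]
    rw [measureReal_eq_zero_iff] at h0
    filter_upwards [measure_eq_zero_iff_ae_notMem.1 h0] with ω hω h1 h2
    exact absurd ⟨h2, h1⟩ hω
  filter_upwards [ae_all_iff.2 h] with ω hω h1
  exact hω _ h1 rfl

/-! ### First jump times and the transition from the one-block state -/

section FirstJump

theorem IsFragmentation.eventually_restr_eq (hX : IsFragmentation P X) (n : ℕ) (ω : Ω) {t : ℝ}
    (ht : t ∈ Ico (0 : ℝ) 1) : ∀ᶠ u in 𝓝[>] t, restr n (X u ω) = restr n (X t ω) := by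
  have h := (hX.right_continuous ω t ht).eventually_lt_const
    -- The shift to `n + 1` keeps the denominator positive when `n = 0`.
    (show (0 : ℝ) < 1 / ((n + 1 : ℕ) : ℝ) by positivity)
  filter_upwards [h] with u hu
  exact restr_eq_mono (by omega) ((partDist_lt_iff (by omega)).1 hu)

theorem firstJump_bddBelow (n : ℕ) (ω : Ω) :
    BddBelow (insert 1 {t | t ∈ Ico (0 : ℝ) 1 ∧ restr n (X t ω) ≠ ⊤}) := by
  refine ⟨0, ?_⟩
  rintro x (rfl | h)
  · exact zero_le_one
  · exact h.1.1

theorem firstJump_le_one (n : ℕ) (ω : Ω) : firstJump X n ω ≤ 1 :=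
  csInf_le (firstJump_bddBelow n ω) (mem_insert _ _)

theorem firstJump_le {n : ℕ} {ω : Ω} {t : ℝ} (ht : t ∈ Ico (0 : ℝ) 1)
    (h : restr n (X t ω) ≠ ⊤) : firstJump X n ω ≤ t :=
  csInf_le (firstJump_bddBelow n ω) (Or.inr ⟨ht, h⟩)

theorem firstJump_lt_iff {n : ℕ} {ω : Ω} {t : ℝ} (ht : t ≤ 1) :
    firstJump X n ω < t ↔ ∃ u, 0 ≤ u ∧ u < t ∧ restr n (X u ω) ≠ ⊤ := by
  unfold firstJump
  rw [csInf_lt_iff (firstJump_bddBelow n ω) (insert_nonempty _ _)]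
  constructor
  · rintro ⟨u, rfl | h, hu⟩
    · exact absurd hu ht.not_gt
    · exact ⟨u, h.1.1, hu, h.2⟩
  · rintro ⟨u, h0, hu, h⟩
    exact ⟨u, Or.inr ⟨⟨h0, hu.trans_le ht⟩, h⟩, hu⟩

/-- By right-continuity, a state different from `⊤` persists on an interval to the right, which
contains a rational. This yields measurability and lets almost sure statements at fixed times be
combined. -/
theorem IsFragmentation.firstJump_lt_iff_rat (hX : IsFragmentation P X) {n : ℕ} {ω : Ω} {t : ℝ}
    (ht : t ≤ 1) :
    firstJump X n ω < t ↔ ∃ q : ℚ, 0 ≤ (q : ℝ) ∧ (q : ℝ) < t ∧ restr n (X q ω) ≠ ⊤ := by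
  rw [firstJump_lt_iff ht]
  constructor
  · rintro ⟨u, h0, hu, h⟩
    have h1 := hX.eventually_restr_eq n ω ⟨h0, hu.trans_le ht⟩
    obtain ⟨v, hv, hv'⟩ := mem_nhdsGT_iff_exists_Ioo_subset.1 h1
    obtain ⟨q, hq1, hq2⟩ := exists_rat_btwn (lt_min hv hu)
    refine ⟨q, h0.trans hq1.le, hq2.trans_le (min_le_right _ _), ?_⟩
    have : restr n (X q ω) = restr n (X u ω) := hv' ⟨hq1, hq2.trans_le (min_le_left _ _)⟩
    rwa [this]
  · rintro ⟨q, h0, hq, h⟩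
    exact ⟨q, h0, hq, h⟩

theorem IsFragmentation.measurable_firstJump (hX : IsFragmentation P X) (n : ℕ) :
    Measurable (firstJump X n) := by
  refine measurable_of_Iio fun t => ?_
  rcases le_or_gt t 1 with ht | ht
  · have : firstJump X n ⁻¹' Iio t =
        ⋃ (q : ℚ) (_ : 0 ≤ (q : ℝ) ∧ (q : ℝ) < t), (X q ⁻¹' cylinder n ⊤)ᶜ := by
      ext ω
      simp only [mem_preimage, mem_Iio, hX.firstJump_lt_iff_rat ht, mem_iUnion, mem_compl_iff,
        exists_prop, and_assoc]
      rfl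
    rw [this]
    refine MeasurableSet.iUnion fun q => MeasurableSet.iUnion fun hq => ?_
    exact (hX.measurableSet_cylinder ⟨hq.1, hq.2.trans_le ht⟩ n ⊤).compl
  · have : firstJump X n ⁻¹' Iio t = univ :=
      eq_univ_of_forall fun ω => (firstJump_le_one n ω).trans_lt ht
    rw [this]
    exact MeasurableSet.univ

/-- Irreversibility is known almost surely only for each fixed pair of times; testing at the
countably many rational times suffices. -/
theorem ae_le_firstJump (hX : IsFragmentation P X) {t : ℝ} (ht : t ∈ Ico (0 : ℝ) 1) (n : ℕ) :
    ∀ᵐ ω ∂P, restr n (X t ω) = ⊤ → t ≤ firstJump X n ω := by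
  have h : ∀ q : ℚ, ∀ᵐ ω ∂P, 0 ≤ (q : ℝ) → (q : ℝ) < t → restr n (X t ω) = ⊤ →
      restr n (X q ω) = ⊤ := by
    intro q
    by_cases hq : 0 ≤ (q : ℝ) ∧ (q : ℝ) < t
    · filter_upwards [ae_restr_eq_top_of_le hX hq.1 hq.2.le ht.2 n] with ω hω _ _
      exact hω
    · exact Eventually.of_forall fun _ h1 h2 => absurd ⟨h1, h2⟩ hq
  filter_upwards [ae_all_iff.2 h] with ω hω htop
  by_contra hlt
  obtain ⟨q, h0, hq, hne⟩ := (hX.firstJump_lt_iff_rat ht.2.le).1 (not_le.1 hlt)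
  exact hne (hω q h0 hq htop)

variable {g : ℕ → ℝ → ℝ} {h : (n : ℕ) → Setoid (Fin n) → ℝ → ℝ}

theorem setLIntegral_jumpLaw (hreg : HasRegularJumps P X g h) {n : ℕ} (hn : 2 ≤ n) {A : Set ℝ}
    (hA : MeasurableSet A) (hA' : A ⊆ Ico 0 1) {f : ℝ → ℝ≥0∞}
    (hf : AEMeasurable f (volume.restrict A)) :
    ∫⁻ t in A, f t ∂(jumpLaw P X n) = ∫⁻ t in A, ENNReal.ofReal (g n t) * f t := by
  have h1 : (jumpLaw P X n).restrict A =
      (volume.restrict A).withDensity fun t => ENNReal.ofReal (g n t) := by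
    rw [← inter_eq_self_of_subset_left hA', ← Measure.restrict_restrict hA, hreg.g_density n hn,
      restrict_withDensity hA, Measure.restrict_restrict hA]
  have hg : AEMeasurable (fun t => ENNReal.ofReal (g n t)) (volume.restrict A) :=
    ((hreg.g_continuous n hn).mono hA').aemeasurable hA |>.ennreal_ofReal
  rw [h1, lintegral_withDensity_eq_lintegral_mul₀ hg hf]
  rfl

theorem measure_firstJump_mem (hX : IsFragmentation P X) (hreg : HasRegularJumps P X g h) {n : ℕ}
    (hn : 2 ≤ n) {A : Set ℝ} (hA : MeasurableSet A) (hA' : A ⊆ Ico 0 1) :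
    P {ω | firstJump X n ω ∈ A} = ∫⁻ t in A, ENNReal.ofReal (g n t) := by
  have h1 := setLIntegral_jumpLaw hreg hn hA hA' (f := fun _ => 1) aemeasurable_const
  simp only [lintegral_const, mul_one, one_mul, Measure.restrict_apply_univ] at h1
  rw [← h1, jumpLaw, Measure.map_apply (hX.measurable_firstJump n) hA]
  rfl

theorem ae_firstJump_ne (hX : IsFragmentation P X) (hreg : HasRegularJumps P X g h) {n : ℕ}
    (hn : 2 ≤ n) {t : ℝ} (ht : t ∈ Ico (0 : ℝ) 1) : ∀ᵐ ω ∂P, firstJump X n ω ≠ t := by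
  have h1 := measure_firstJump_mem hX hreg hn (measurableSet_singleton t)
    (singleton_subset_iff.2 ht)
  rw [Measure.restrict_singleton, Real.volume_singleton, zero_smul, lintegral_zero_measure] at h1
  filter_upwards [measure_eq_zero_iff_ae_notMem.1 h1] with ω hω heq
  exact hω heq

/-- The two events differ only when the jump occurs exactly at `t`, which has probability zero
because the law of the jump time has a density. -/
theorem ae_le_firstJump_iff (hX : IsFragmentation P X) (hreg : HasRegularJumps P X g h) {n : ℕ}
    (hn : 2 ≤ n) {t : ℝ} (ht : t ∈ Ico (0 : ℝ) 1) :
    ∀ᵐ ω ∂P, t ≤ firstJump X n ω ↔ restr n (X t ω) = ⊤ := by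
  filter_upwards [ae_le_firstJump hX ht n, ae_firstJump_ne hX hreg hn ht] with ω h1 h2
  refine ⟨fun hle => ?_, h1⟩
  by_contra hne
  exact h2 (le_antisymm (firstJump_le ht hne) hle)

theorem jumpTail_eq (hX : IsFragmentation P X) (hreg : HasRegularJumps P X g h) {n : ℕ}
    (hn : 2 ≤ n) {t : ℝ} (ht : t ∈ Ico (0 : ℝ) 1) :
    jumpTail P X n t = P.real (X t ⁻¹' cylinder n ⊤) :=
  measureReal_congr (eventuallyEq_set.2 (ae_le_firstJump_iff hX hreg hn ht))

theorem jumpTail_antitone (n : ℕ) : Antitone (jumpTail P X n) :=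
  fun _ _ hst => measureReal_mono fun _ hω => hst.trans hω

/-- Conditioning on the one-block state, of positive probability, pins down the chosen transition
law on `[n]` in terms of the process alone. -/
theorem transitionLaw_cylinder (hX : IsFragmentation P X) (hreg : HasRegularJumps P X g h)
    {s t : ℝ} (hs : 0 ≤ s) (hst : s ≤ t) (ht : t < 1) {n : ℕ} (hn : 2 ≤ n) (π : Setoid (Fin n)) :
    (transitionLaw hX s t).real (cylinder n π) =
      (jumpTail P X n s)⁻¹ * P.real (X s ⁻¹' cylinder n ⊤ ∩ X t ⁻¹' cylinder n π) := by
  have hs' : s ∈ Ico (0 : ℝ) 1 := ⟨hs, hst.trans_lt ht⟩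
  rw [measure_cylinder_top_inter hX hs hst ht, ← jumpTail_eq hX hreg hn hs',
    inv_mul_cancel_left₀ (hreg.tail_pos n hn s hs').ne']

theorem transitionLaw_cylinder_top (hX : IsFragmentation P X) (hreg : HasRegularJumps P X g h)
    {s t : ℝ} (hs : 0 ≤ s) (hst : s ≤ t) (ht : t < 1) {n : ℕ} (hn : 2 ≤ n) :
    (transitionLaw hX s t).real (cylinder n ⊤) = (jumpTail P X n s)⁻¹ * jumpTail P X n t := by
  rw [transitionLaw_cylinder hX hreg hs hst ht hn, jumpTail_eq hX hreg hn ⟨hs.trans hst, ht⟩]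
  congr 1
  refine measureReal_congr (eventuallyEq_set.2 ?_)
  filter_upwards [ae_restr_eq_top_of_le hX hs hst ht n] with ω hω
  exact ⟨fun h => h.2, fun h => ⟨hω h, h⟩⟩

end FirstJump

end Markov

/-! ### Two jumps in a short interval -/

section TwoJumps

variable {Ω : Type*} [MeasurableSpace Ω] {P : Measure Ω} [IsProbabilityMeasure P]
  {X : ℝ → Ω → Setoid ℕ} {g : ℕ → ℝ → ℝ} {h : (n : ℕ) → Setoid (Fin n) → ℝ → ℝ}

/-- The left side is a ratio of tails; enlarging its numerator and shrinking its denominator makes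
the bound independent of `b`, so that it can be summed over a grid. -/
theorem one_sub_transitionLaw_cylinder_top_le (hX : IsFragmentation P X)
    (hreg : HasRegularJumps P X g h) {n : ℕ} (hn : 2 ≤ n) {t b u : ℝ} (ht : 0 ≤ t) (htb : t ≤ b)
    (hbu : b ≤ u) (hu : u < 1) :
    1 - (transitionLaw hX b u).real (cylinder n ⊤) ≤
      (jumpTail P X n t - jumpTail P X n u) / jumpTail P X n u := by
  have hb0 := ht.trans htb
  have hLu := hreg.tail_pos n hn u ⟨hb0.trans hbu, hu⟩
  have hLb := hreg.tail_pos n hn b ⟨hb0, hbu.trans_lt hu⟩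
  have h1 : jumpTail P X n b ≤ jumpTail P X n t := jumpTail_antitone n htb
  have h2 : jumpTail P X n u ≤ jumpTail P X n b := jumpTail_antitone n hbu
  rw [transitionLaw_cylinder_top hX hreg hb0 hbu hu hn]
  have h3 : 1 - (jumpTail P X n b)⁻¹ * jumpTail P X n u =
      (jumpTail P X n b - jumpTail P X n u) / jumpTail P X n b := by
    field_simp
  rw [h3]
  exact div_le_div₀ (by linarith) (by linarith) hLu h2

/-- Bound on the probability that the restriction to `[n]` jumps during `[a, b]` and then once
more before `u`. -/
theorem measure_jump_then_jump_le (hX : IsFragmentation P X) (hreg : HasRegularJumps P X g h)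
    {n : ℕ} (hn : 2 ≤ n) {t a b u : ℝ} (ht : 0 ≤ t) (hta : t ≤ a) (hab : a ≤ b)
    (hbu : b ≤ u) (hu : u < 1) :
    P.real ((X a ⁻¹' cylinder n ⊤ ∩ (X b ⁻¹' cylinder n ⊤)ᶜ) ∩
        {ω | restr n (X b ω) ≠ restr n (X u ω)}) ≤
      (jumpTail P X n a - jumpTail P X n b) *
        (n * ((jumpTail P X n t - jumpTail P X n u) / jumpTail P X n u)) := by
  classical
  have ha0 := ht.trans hta
  have hb0 := ha0.trans hab
  have hb : b ∈ Ico (0 : ℝ) 1 := ⟨hb0, hbu.trans_lt hu⟩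
  have ha : a ∈ Ico (0 : ℝ) 1 := ⟨ha0, hab.trans_lt hb.2⟩
  have hu' : u ∈ Ico (0 : ℝ) 1 := ⟨hb0.trans hbu, hu⟩
  set c := (n : ℝ) * ((jumpTail P X n t - jumpTail P X n u) / jumpTail P X n u) with hc
  -- Splitting by the state at time `b` allows the Markov property to be applied there; the masses
  -- of `A σ` over `σ ≠ ⊤` add up to the difference of tails at `a` and `b`.
  let A : Setoid (Fin n) → Set Ω := fun σ => X a ⁻¹' cylinder n ⊤ ∩ X b ⁻¹' cylinder n σ
  have hAm : ∀ σ, MeasurableSet[past X b] (A σ) := fun σ =>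
    (measurableSet_past_cylinder ha0 hab n ⊤).inter (measurableSet_past_cylinder hb0 le_rfl n σ)
  have hA : ∀ σ, P.real (A σ ∩ (X u ⁻¹' cylinder n σ)ᶜ) ≤ P.real (A σ) * c := by
    intro σ
    have h1 := measure_past_inter_cylinder hX hb0 hbu hu (x := liftPartition σ) (hAm σ)
      (by rw [restr_liftPartition]; exact inter_subset_right) σ
    have h2 := measureReal_inter_add_sdiff (μ := P) (s := A σ)
      (hX.measurableSet_cylinder hu' n σ)
    have h3 := one_sub_fragLaw_cylinder_le (transitionLaw hX b u) n (liftPartition σ)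
    rw [restr_liftPartition] at h3
    have h4 := one_sub_transitionLaw_cylinder_top_le hX hreg hn ht (hta.trans hab) hbu hu
    have h5 : 1 - (fragLaw (transitionLaw hX b u) (liftPartition σ)).real (cylinder n σ) ≤ c :=
      h3.trans (mul_le_mul_of_nonneg_left h4 (Nat.cast_nonneg n))
    have h6 := mul_le_mul_of_nonneg_left h5 (measureReal_nonneg (μ := P) (s := A σ))
    rw [sdiff_eq] at h2
    linarith
  have hsub : (X a ⁻¹' cylinder n ⊤ ∩ (X b ⁻¹' cylinder n ⊤)ᶜ) ∩
      {ω | restr n (X b ω) ≠ restr n (X u ω)} ⊆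
      ⋃ σ ∈ Finset.univ.erase (⊤ : Setoid (Fin n)), A σ ∩ (X u ⁻¹' cylinder n σ)ᶜ := by
    rintro ω ⟨⟨h1, h2⟩, h3⟩
    simp only [mem_iUnion]
    exact ⟨restr n (X b ω), Finset.mem_erase.2 ⟨h2, Finset.mem_univ _⟩, ⟨h1, rfl⟩,
      fun h4 => h3 h4.symm⟩
  have hfin : P (⋃ σ ∈ Finset.univ.erase (⊤ : Setoid (Fin n)),
      A σ ∩ (X u ⁻¹' cylinder n σ)ᶜ) ≠ ∞ := measure_ne_top _ _
  refine (measureReal_mono hsub hfin).trans ((measureReal_biUnion_finset_le _ _).trans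
    ((Finset.sum_le_sum fun σ _ => hA σ).trans (le_of_eq ?_)))
  rw [← Finset.sum_mul]
  congr 1
  have h1 : ∑ σ : Setoid (Fin n), P.real (A σ) = jumpTail P X n a := by
    have := sum_cylinder_inter P (Y := fun ω => restr n (X b ω))
      ((measurable_restr n).comp (hX.measurable b hb)) (X a ⁻¹' cylinder n ⊤) Finset.univ
    rw [Finset.coe_univ, preimage_univ, inter_univ] at this
    rw [jumpTail_eq hX hreg hn ha, this]
    rfl
  have h2 : P.real (A ⊤) = jumpTail P X n b := by
    rw [jumpTail_eq hX hreg hn hb]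
    refine measureReal_congr (eventuallyEq_set.2 ?_)
    filter_upwards [ae_restr_eq_top_of_le hX ha0 hab hb.2 n] with ω hω
    exact ⟨fun h => h.2, fun h => ⟨hω h, h⟩⟩
  rw [Finset.sum_erase_eq_sub (Finset.mem_univ _), h1, h2]

/-- No strong Markov property is needed: on a fine grid of `[t, u]`, the state just after the first
jump is, by right-continuity, the state at the next grid point. The bounds for the cells of the grid
telescope to one independent of the mesh. -/
theorem measure_firstJump_then_jump_le (hX : IsFragmentation P X) (hreg : HasRegularJumps P X g h)
    {n : ℕ} (hn : 2 ≤ n) {t u : ℝ} (ht : 0 ≤ t) (htu : t < u) (hu : u < 1) :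
    P.real {ω | firstJump X n ω ∈ Icc t u ∧ restr n (X (firstJump X n ω) ω) ≠ restr n (X u ω)} ≤
      (jumpTail P X n t - jumpTail P X n u) *
        (n * ((jumpTail P X n t - jumpTail P X n u) / jumpTail P X n u)) := by
  set c := (n : ℝ) * ((jumpTail P X n t - jumpTail P X n u) / jumpTail P X n u) with hc
  have hut : 0 < u - t := sub_pos.2 htu
  -- The `k`-th point of the subdivision of `[t, u]` into `N + 1` equal cells.
  let T : ℕ → ℕ → ℝ := fun N k => t + (u - t) * (k / ((N + 1 : ℕ) : ℝ))
  have hTmono : ∀ N, Monotone (T N) := by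
    intro N i j hij
    have : (i : ℝ) ≤ j := by exact_mod_cast hij
    simp only [T]
    gcongr
  have hT0 : ∀ N, T N 0 = t := fun N => by simp [T]
  have hTN : ∀ N, T N (N + 1) = u := fun N => by
    simp only [T]
    rw [div_self (by positivity)]
    ring
  have hTIcc : ∀ N k, k ≤ N + 1 → T N k ∈ Icc t u := fun N k hk =>
    ⟨hT0 N ▸ hTmono N (Nat.zero_le k), hTN N ▸ hTmono N hk⟩
  have hTIco : ∀ N k, k ≤ N + 1 → T N k ∈ Ico (0 : ℝ) 1 := fun N k hk =>
    ⟨ht.trans (hTIcc N k hk).1, (hTIcc N k hk).2.trans_lt hu⟩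
  let G : ℕ → Set Ω := fun N => ⋃ k ∈ Finset.range (N + 1),
    (X (T N k) ⁻¹' cylinder n ⊤ ∩ (X (T N (k + 1)) ⁻¹' cylinder n ⊤)ᶜ) ∩
        {ω | restr n (X (T N (k + 1)) ω) ≠ restr n (X u ω)}
  have hG : ∀ N, P.real (G N) ≤ (jumpTail P X n t - jumpTail P X n u) * c := by
    intro N
    refine (measureReal_biUnion_finset_le _ _).trans ?_
    refine (Finset.sum_le_sum fun k hk => measure_jump_then_jump_le hX hreg hn ht
      (hTIcc N k ?_).1 (hTmono N (Nat.le_succ k)) (hTIcc N (k + 1) ?_).2 hu).trans (le_of_eq ?_)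
    · exact (Finset.mem_range.1 hk).le
    · exact Finset.mem_range.1 hk
    · rw [← Finset.sum_mul, Finset.sum_range_sub' (fun k => jumpTail P X n (T N k)), hT0, hTN]
  have hae : ∀ᵐ ω ∂P, ∀ N k, k ≤ N + 1 →
      (T N k ≤ firstJump X n ω ↔ restr n (X (T N k) ω) = ⊤) := by
    refine ae_all_iff.2 fun N => ae_all_iff.2 fun k => ?_
    by_cases hk : k ≤ N + 1
    · filter_upwards [ae_le_firstJump_iff hX hreg hn (hTIco N k hk)] with ω hω _
      exact hω
    · exact Eventually.of_forall fun _ hk' => absurd hk' hk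
  have hsub : ∀ᵐ ω ∂P, (firstJump X n ω ∈ Icc t u ∧
      restr n (X (firstJump X n ω) ω) ≠ restr n (X u ω)) → ω ∈ ⋃ M, ⋂ N ≥ M, G N := by
    filter_upwards [hae] with ω hω
    rintro ⟨⟨h1, h2⟩, hne⟩
    -- A first jump exactly at `u` leaves no room for a different state at `u`.
    have h3 : firstJump X n ω < u := by
      refine lt_of_le_of_ne h2 fun heq => hne ?_
      rw [heq]
    set τ := firstJump X n ω with hτ
    have hright := hX.eventually_restr_eq n ω (t := τ) ⟨ht.trans h1, h3.trans hu⟩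
    obtain ⟨v, hv, hv'⟩ := mem_nhdsGT_iff_exists_Ioo_subset.1 hright
    have hδ : 0 < (v - τ) / (u - t) := div_pos (sub_pos.2 hv) hut
    obtain ⟨M, hM⟩ := exists_nat_one_div_lt hδ
    refine mem_iUnion.2 ⟨M, mem_iInter₂.2 fun N hN => ?_⟩
    have hN0 : (0 : ℝ) < ((N + 1 : ℕ) : ℝ) := by positivity
    -- The position of `τ` in units of the mesh: `⌊r⌋₊` is the index of the cell containing it, and
    -- its right endpoint lies before `v` once `N ≥ M`.
    set r := (τ - t) / (u - t) * ((N + 1 : ℕ) : ℝ) with hr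
    have hr0 : 0 ≤ r := mul_nonneg (div_nonneg (by linarith) hut.le) hN0.le
    have hrN : r < ((N + 1 : ℕ) : ℝ) := by
      have : (τ - t) / (u - t) < 1 := (div_lt_one hut).2 (by linarith)
      nlinarith
    have hτr : τ = t + (u - t) * (r / ((N + 1 : ℕ) : ℝ)) := by
      rw [hr]
      field_simp
      ring
    have hkN : ⌊r⌋₊ < N + 1 := (Nat.floor_lt hr0).2 hrN
    have hk1 : T N ⌊r⌋₊ ≤ τ := by
      rw [hτr]
      have := Nat.floor_le hr0
      simp only [T]
      gcongr
    have hk2 : τ < T N (⌊r⌋₊ + 1) := by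
      rw [hτr]
      have : r < ((⌊r⌋₊ + 1 : ℕ) : ℝ) := by exact_mod_cast Nat.lt_floor_add_one r
      simp only [T]
      gcongr
    have hk3 : T N (⌊r⌋₊ + 1) < v := by
      have e1 : T N (⌊r⌋₊ + 1) = T N ⌊r⌋₊ + (u - t) * (1 / ((N + 1 : ℕ) : ℝ)) := by
        simp only [T]
        push_cast
        ring
      have e2 : 1 / ((N + 1 : ℕ) : ℝ) ≤ 1 / ((M : ℝ) + 1) := by
        refine one_div_le_one_div_of_le (by positivity) ?_
        have : (M : ℝ) ≤ N := by exact_mod_cast hN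
        push_cast
        linarith
      have e3 : (u - t) * (1 / ((N + 1 : ℕ) : ℝ)) < v - τ := by
        have := mul_lt_mul_of_pos_left (e2.trans_lt hM) hut
        rwa [mul_div_cancel₀ _ hut.ne'] at this
      linarith
    have heq : restr n (X (T N (⌊r⌋₊ + 1)) ω) = restr n (X τ ω) := hv' ⟨hk2, hk3⟩
    refine mem_iUnion₂.2 ⟨⌊r⌋₊, Finset.mem_range.2 hkN, ⟨?_, ?_⟩, ?_⟩
    · exact (hω N _ hkN.le).1 hk1
    · exact fun htop => hk2.not_ge ((hω N _ hkN).2 htop)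
    · change restr n (X (T N (⌊r⌋₊ + 1)) ω) ≠ _
      rwa [heq]
  -- The event lies in the lower limit of the `G N`, whose probability is at most the common bound
  -- by monotone continuity.
  have hle : P (⋃ M, ⋂ N ≥ M, G N) ≤
      ENNReal.ofReal ((jumpTail P X n t - jumpTail P X n u) * c) := by
    have hmono : Monotone fun M => ⋂ N ≥ M, G N := fun M M' hM ω hω =>
      mem_iInter₂.2 fun N hN => mem_iInter₂.1 hω N (hM.trans hN)
    rw [hmono.measure_iUnion]
    refine iSup_le fun M => (measure_mono (iInter₂_subset M le_rfl)).trans ?_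
    rw [← ofReal_measureReal (measure_ne_top _ _)]
    exact ENNReal.ofReal_le_ofReal (hG M)
  refine ENNReal.toReal_le_of_le_ofReal (measureReal_nonneg.trans (hG 0)) ?_
  exact (measure_mono_ae hsub).trans hle

end TwoJumps

/-! ### Jump rates as right derivatives of transition probabilities -/

section JumpRate

theorem toReal_lintegral_eq_intervalIntegral {f : ℝ → ℝ} (hf : ContinuousOn f (Ico 0 1))
    (hf0 : ∀ x ∈ Ico (0 : ℝ) 1, 0 ≤ f x) {t s : ℝ} (ht : 0 ≤ t) (hs : 0 ≤ s) (hts : t + s < 1) :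
    (∫⁻ x in Icc t (t + s), ENNReal.ofReal (f x)).toReal = ∫ x in t..t + s, f x := by
  have hsub : Icc t (t + s) ⊆ Ico 0 1 := fun x hx => ⟨ht.trans hx.1, hx.2.trans_lt hts⟩
  rw [intervalIntegral.integral_of_le (by linarith), ← integral_Icc_eq_integral_Ioc,
    integral_eq_lintegral_of_nonneg_ae]
  · exact (ae_restrict_iff' measurableSet_Icc).2 (Eventually.of_forall fun x hx => hf0 x (hsub hx))
  · exact (hf.mono hsub).aestronglyMeasurable measurableSet_Icc

theorem eventually_add_lt_one {t : ℝ} (ht : t < 1) : ∀ᶠ s : ℝ in 𝓝[>] 0, 0 < s ∧ t + s < 1 := by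
  filter_upwards [Ioo_mem_nhdsGT (sub_pos.2 ht)] with s hs
  exact ⟨hs.1, by linarith [hs.2]⟩

theorem tendsto_inv_mul_lintegral_Icc {f : ℝ → ℝ} (hf : ContinuousOn f (Ico 0 1))
    (hf0 : ∀ x ∈ Ico (0 : ℝ) 1, 0 ≤ f x) {t : ℝ} (ht : t ∈ Ico (0 : ℝ) 1) :
    Tendsto (fun s : ℝ => s⁻¹ * (∫⁻ x in Icc t (t + s), ENNReal.ofReal (f x)).toReal)
      (𝓝[>] 0) (𝓝 (f t)) := by
  have hle : 𝓝[>] t ≤ 𝓝[Ico 0 1] t := by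
    refine le_inf nhdsWithin_le_nhds (le_principal_iff.2 ?_)
    filter_upwards [Ioo_mem_nhdsGT ht.2] with x hx
    exact ⟨ht.1.trans hx.1.le, hx.2⟩
  -- Only the right derivative is available at `t = 0`, and only it is needed.
  have hder : HasDerivWithinAt (fun u => ∫ x in t..u, f x) (f t) (Ici t) t :=
    intervalIntegral.integral_hasDerivWithinAt_right (t := Ioi t) IntervalIntegrable.refl
      ((hf.stronglyMeasurableAtFilter_nhdsWithin measurableSet_Ico t).filter_mono hle)
      ((hf t ht).mono_left hle)
  have hslope := (hasDerivWithinAt_iff_tendsto_slope' self_notMem_Ioi).1 hder.Ioi_of_Ici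
  have hmap : Tendsto (fun s : ℝ => t + s) (𝓝[>] 0) (𝓝[>] t) := by
    refine tendsto_nhdsWithin_iff.2 ⟨?_, ?_⟩
    · have : Tendsto (fun s : ℝ => t + s) (𝓝 0) (𝓝 (t + 0)) := tendsto_const_nhds.add tendsto_id
      rw [add_zero] at this
      exact this.mono_left nhdsWithin_le_nhds
    · filter_upwards [self_mem_nhdsWithin] with s hs
      exact lt_add_of_pos_right t hs
  refine (hslope.comp hmap).congr' ?_
  filter_upwards [eventually_add_lt_one ht.2] with s hs
  rw [toReal_lintegral_eq_intervalIntegral hf hf0 ht.1 hs.1.le hs.2, Function.comp_apply,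
    slope_def_field, intervalIntegral.integral_same, sub_zero, add_sub_cancel_left,
    div_eq_inv_mul]

variable {Ω : Type*} [MeasurableSpace Ω] {P : Measure Ω} [IsProbabilityMeasure P]
  {X : ℝ → Ω → Setoid ℕ} {g : ℕ → ℝ → ℝ} {h : (n : ℕ) → Setoid (Fin n) → ℝ → ℝ}

theorem Icc_subset_Ico {t u : ℝ} (ht : 0 ≤ t) (hu : u < 1) : Icc t u ⊆ Ico 0 1 :=
  fun _ hx => ⟨ht.trans hx.1, hx.2.trans_lt hu⟩

/-- The joint law of the first jump time and of the state reached has density `h n π * g n`,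
continuous on `[0, 1)`. -/
theorem tendsto_firstJump_restr (hreg : HasRegularJumps P X g h)
    {n : ℕ} {π : Setoid (Fin n)} (hπ : π ≠ ⊤) {t : ℝ} (ht : t ∈ Ico (0 : ℝ) 1) :
    Tendsto (fun s : ℝ => s⁻¹ * P.real {ω | firstJump X n ω ∈ Icc t (t + s) ∧
      restr n (X (firstJump X n ω) ω) = π}) (𝓝[>] 0) (𝓝 (h n π t * g n t)) := by
  have hn := two_le_of_ne_top hπ
  have hcont := (hreg.h_continuous n hn π hπ).mul (hreg.g_continuous n hn)
  refine (tendsto_inv_mul_lintegral_Icc hcont (fun x hx => mul_nonneg (hreg.h_nonneg n hn π hπ x hx)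
    (hreg.g_nonneg n hn x hx)) ht).congr' ?_
  filter_upwards [eventually_add_lt_one ht.2] with s hs
  have hsub := Icc_subset_Ico ht.1 hs.2
  rw [measureReal_def, hreg.h_conditional n hn π hπ _ measurableSet_Icc hsub,
    setLIntegral_jumpLaw hreg hn measurableSet_Icc hsub]
  · congr 2
    refine setLIntegral_congr_fun measurableSet_Icc fun x hx => ?_
    simp only [Pi.mul_apply]
    rw [mul_comm, ENNReal.ofReal_mul (hreg.g_nonneg n hn x (hsub hx))]
  · exact (((hreg.h_continuous n hn π hπ).mono hsub).aemeasurable measurableSet_Icc).ennreal_ofReal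

theorem jumpTail_sub (hX : IsFragmentation P X) (hreg : HasRegularJumps P X g h) {n : ℕ}
    (hn : 2 ≤ n) {t u : ℝ} (ht : 0 ≤ t) (htu : t ≤ u) (hu : u < 1) :
    jumpTail P X n t - jumpTail P X n u =
      (∫⁻ x in Icc t u, ENNReal.ofReal (g n x)).toReal := by
  rw [← measure_firstJump_mem hX hreg hn measurableSet_Icc (Icc_subset_Ico ht hu),
    ← measureReal_def, jumpTail, jumpTail]
  have h1 : {ω | u ≤ firstJump X n ω} ⊆ {ω | t ≤ firstJump X n ω} := fun _ hω => htu.trans hω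
  have hm : MeasurableSet {ω | u ≤ firstJump X n ω} :=
    measurableSet_le measurable_const (hX.measurable_firstJump n)
  rw [← measureReal_sdiff h1 hm]
  refine measureReal_congr (eventuallyEq_set.2 ?_)
  filter_upwards [ae_firstJump_ne hX hreg hn ⟨ht.trans htu, hu⟩] with ω hω
  simp only [Set.mem_sdiff, mem_ofPred_eq, not_le, mem_Icc]
  exact ⟨fun h => ⟨h.1, h.2.le⟩, fun h => ⟨h.1, lt_of_le_of_ne h.2 hω⟩⟩

theorem tendsto_jumpTail_slope (hX : IsFragmentation P X) (hreg : HasRegularJumps P X g h) {n : ℕ}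
    (hn : 2 ≤ n) {t : ℝ} (ht : t ∈ Ico (0 : ℝ) 1) :
    Tendsto (fun s : ℝ => s⁻¹ * (jumpTail P X n t - jumpTail P X n (t + s))) (𝓝[>] 0)
      (𝓝 (g n t)) := by
  refine (tendsto_inv_mul_lintegral_Icc (hreg.g_continuous n hn) (hreg.g_nonneg n hn) ht).congr' ?_
  filter_upwards [eventually_add_lt_one ht.2] with s hs
  rw [jumpTail_sub hX hreg hn ht.1 (by linarith) hs.2]

theorem tendsto_jumpTail_sub (hX : IsFragmentation P X) (hreg : HasRegularJumps P X g h) {n : ℕ}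
    (hn : 2 ≤ n) {t : ℝ} (ht : t ∈ Ico (0 : ℝ) 1) :
    Tendsto (fun s : ℝ => jumpTail P X n t - jumpTail P X n (t + s)) (𝓝[>] 0) (𝓝 0) := by
  have h0 : Tendsto (fun s : ℝ => s) (𝓝[>] 0) (𝓝 0) := nhdsWithin_le_nhds
  have := h0.mul (tendsto_jumpTail_slope hX hreg hn ht)
  rw [zero_mul] at this
  refine this.congr' ?_
  filter_upwards [self_mem_nhdsWithin] with s hs
  exact mul_inv_cancel_left₀ (ne_of_gt hs) _

/-- Up to a null set, the two events differ only on outcomes where the state reached at the first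
jump changes again before `u`. -/
theorem abs_measure_cylinder_sub_measure_firstJump_le (hX : IsFragmentation P X)
    (hreg : HasRegularJumps P X g h) {n : ℕ} {π : Setoid (Fin n)} (hπ : π ≠ ⊤) {t u : ℝ}
    (ht : 0 ≤ t) (htu : t < u) (hu : u < 1) :
    |P.real (X t ⁻¹' cylinder n ⊤ ∩ X u ⁻¹' cylinder n π) -
      P.real {ω | firstJump X n ω ∈ Icc t u ∧ restr n (X (firstJump X n ω) ω) = π}| ≤
    (jumpTail P X n t - jumpTail P X n u) *
        (n * ((jumpTail P X n t - jumpTail P X n u) / jumpTail P X n u)) := by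
  have hn := two_le_of_ne_top hπ
  have ht' : t ∈ Ico (0 : ℝ) 1 := ⟨ht, htu.trans hu⟩
  have hu' : u ∈ Ico (0 : ℝ) 1 := ⟨ht.trans htu.le, hu⟩
  refine le_trans ?_ (measure_firstJump_then_jump_le hX hreg hn ht htu hu)
  set E := X t ⁻¹' cylinder n ⊤ ∩ X u ⁻¹' cylinder n π with hE
  set F := {ω | firstJump X n ω ∈ Icc t u ∧ restr n (X (firstJump X n ω) ω) = π} with hF
  set G := {ω | firstJump X n ω ∈ Icc t u ∧ restr n (X (firstJump X n ω) ω) ≠ restr n (X u ω)}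
    with hG
  have key : ∀ A B : Set Ω, (∀ᵐ ω ∂P, ω ∈ A → ω ∈ B ∪ G) → P.real A - P.real B ≤ P.real G := by
    intro A B hAB
    have h1 : P.real A ≤ P.real (B ∪ G) :=
      ENNReal.toReal_mono (measure_ne_top _ _) (measure_mono_ae hAB)
    have h2 := measureReal_union_le (μ := P) B G
    linarith
  refine abs_sub_le_iff.2 ⟨key _ _ ?_, key _ _ ?_⟩
  · filter_upwards [ae_le_firstJump_iff hX hreg hn ht'] with ω h1
    rintro ⟨h2, h3⟩
    have hmem : firstJump X n ω ∈ Icc t u := by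
      refine ⟨h1.2 h2, firstJump_le hu' ?_⟩
      intro h4
      exact hπ (h3.symm.trans h4)
    by_cases h5 : restr n (X (firstJump X n ω) ω) = π
    · exact Or.inl ⟨hmem, h5⟩
    · exact Or.inr ⟨hmem, fun h6 => h5 (h6.trans h3)⟩
  · filter_upwards [ae_le_firstJump_iff hX hreg hn ht'] with ω h1
    rintro ⟨h2, h3⟩
    by_cases h5 : restr n (X u ω) = π
    · exact Or.inl ⟨h1.1 h2.1, h5⟩
    · exact Or.inr ⟨h2, fun h6 => h5 (h6.symm.trans h3)⟩

/-- The jump rates are the right derivatives of the transition probabilities. -/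
theorem tendsto_transitionLaw_cylinder (hX : IsFragmentation P X) (hreg : HasRegularJumps P X g h)
    {n : ℕ} {π : Setoid (Fin n)} (hπ : π ≠ ⊤) {t : ℝ} (ht : t ∈ Ico (0 : ℝ) 1) :
    Tendsto (fun s : ℝ => s⁻¹ * (transitionLaw hX t (t + s)).real (cylinder n π)) (𝓝[>] 0)
      (𝓝 (jumpRate P X g h n π t)) := by
  have hn := two_le_of_ne_top hπ
  have hL := hreg.tail_pos n hn t ht
  have h1 := tendsto_firstJump_restr hreg hπ ht
  have hsub := tendsto_jumpTail_sub hX hreg hn ht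
  have hLs : Tendsto (fun s : ℝ => jumpTail P X n (t + s)) (𝓝[>] 0) (𝓝 (jumpTail P X n t)) := by
    have := (tendsto_const_nhds (x := jumpTail P X n t)).sub hsub
    simpa using this
  -- The two-jump bound divided by `s` is a slope tending to `g n t` times a factor tending to zero.
  have herr := (tendsto_jumpTail_slope hX hreg hn ht).mul
    ((tendsto_const_nhds (x := (n : ℝ))).mul (hsub.div hLs hL.ne'))
  rw [zero_div, mul_zero, mul_zero] at herr
  have h2 : Tendsto (fun s : ℝ => s⁻¹ * P.real (X t ⁻¹' cylinder n ⊤ ∩ X (t + s) ⁻¹' cylinder n π) -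
      s⁻¹ * P.real {ω | firstJump X n ω ∈ Icc t (t + s) ∧ restr n (X (firstJump X n ω) ω) = π})
      (𝓝[>] 0) (𝓝 0) := by
    refine squeeze_zero_norm' ?_ herr
    filter_upwards [eventually_add_lt_one ht.2] with s hs
    rw [← mul_sub, Real.norm_eq_abs, abs_mul, abs_of_pos (inv_pos.2 hs.1), mul_assoc]
    exact mul_le_mul_of_nonneg_left (abs_measure_cylinder_sub_measure_firstJump_le hX hreg hπ ht.1
      (by linarith) hs.2) (inv_pos.2 hs.1).le
  have h3 := (h2.add h1).const_mul (jumpTail P X n t)⁻¹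
  have hval : (jumpTail P X n t)⁻¹ * (0 + h n π t * g n t) = jumpRate P X g h n π t := by
    unfold jumpRate
    field_simp
    ring
  rw [hval] at h3
  refine h3.congr' ?_
  filter_upwards [eventually_add_lt_one ht.2] with s hs
  rw [transitionLaw_cylinder hX hreg ht.1 (by linarith) hs.2 hn]
  ring

theorem tendsto_cond_firstJump (hX : IsFragmentation P X) (hreg : HasRegularJumps P X g h)
    {n : ℕ} {π : Setoid (Fin n)} (hπ : π ≠ ⊤) {t : ℝ} (ht : t ∈ Ico (0 : ℝ) 1) :
    Tendsto (fun s : ℝ => s⁻¹ * (ProbabilityTheory.cond P {ω | t ≤ firstJump X n ω}).real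
          {ω | restr n (X (firstJump X n ω) ω) = π ∧ firstJump X n ω ∈ Icc t (t + s)})
        (𝓝[>] 0) (𝓝 (jumpRate P X g h n π t)) := by
  have hm : MeasurableSet {ω | t ≤ firstJump X n ω} :=
    measurableSet_le measurable_const (hX.measurable_firstJump n)
  have h1 := (tendsto_firstJump_restr hreg hπ ht).const_mul (jumpTail P X n t)⁻¹
  have hval : (jumpTail P X n t)⁻¹ * (h n π t * g n t) = jumpRate P X g h n π t := by
    unfold jumpRate
    ring
  rw [hval] at h1
  refine h1.congr fun s => ?_
  rw [measureReal_def (ProbabilityTheory.cond P _), ProbabilityTheory.cond_apply hm,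
    ENNReal.toReal_mul, ENNReal.toReal_inv, ← measureReal_def, ← measureReal_def, mul_left_comm]
  congr 3
  ext ω
  simp only [mem_inter_iff, mem_ofPred_eq]
  exact ⟨fun h => ⟨h.1.1, h.2, h.1⟩, fun h => ⟨h.2.2, h.2.1⟩⟩

theorem jumpRate_nonneg (hreg : HasRegularJumps P X g h)
    {n : ℕ} {π : Setoid (Fin n)} (hπ : π ≠ ⊤) {t : ℝ} (ht : t ∈ Ico (0 : ℝ) 1) :
    0 ≤ jumpRate P X g h n π t := by
  have hn := two_le_of_ne_top hπ
  exact mul_nonneg (hreg.h_nonneg n hn π hπ t ht)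
    (div_nonneg (hreg.g_nonneg n hn t ht) (hreg.tail_pos n hn t ht).le)

end JumpRate

/-! ### Existence and uniqueness of the jump measure -/

section JumpMeasure

/-- The sets of partitions that depend on a restriction `π_{|n}` only, and that do not contain the
one-block partition. -/
def cylinderRing : Set (Set (Setoid ℕ)) :=
  {S | ∃ (n : ℕ) (A : Set (Setoid (Fin n))), ⊤ ∉ A ∧ S = restr n ⁻¹' A}

theorem cylinder_mem_cylinderRing {n : ℕ} {π : Setoid (Fin n)} (hπ : π ≠ ⊤) :
    cylinder n π ∈ cylinderRing :=
  ⟨n, {π}, fun h => hπ h.symm, rfl⟩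

theorem exists_common_level {S T : Set (Setoid ℕ)} (hS : S ∈ cylinderRing) (hT : T ∈ cylinderRing) :
    ∃ (n : ℕ) (A B : Set (Setoid (Fin n))), ⊤ ∉ A ∧ ⊤ ∉ B ∧ S = restr n ⁻¹' A ∧
      T = restr n ⁻¹' B := by
  obtain ⟨n, A, hA, rfl⟩ := hS
  obtain ⟨m, B, hB, rfl⟩ := hT
  exact ⟨max n m, restrFin (le_max_left n m) ⁻¹' A, restrFin (le_max_right n m) ⁻¹' B, hA, hB,
    rfl, rfl⟩

theorem isSetRing_cylinderRing : IsSetRing cylinderRing where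
  empty_mem := ⟨0, ∅, notMem_empty _, rfl⟩
  union_mem := by
    intro S T hS hT
    obtain ⟨n, A, B, hA, hB, rfl, rfl⟩ := exists_common_level hS hT
    exact ⟨n, A ∪ B, fun h => h.elim hA hB, rfl⟩
  sdiff_mem := by
    intro S T hS hT
    obtain ⟨n, A, B, hA, hB, rfl, rfl⟩ := exists_common_level hS hT
    exact ⟨n, A \ B, fun h => hA h.1, rfl⟩

/-- The missing cylinder over `⊤` is the complement of a finite union of the others at the same
level. -/
theorem le_generateFrom_of_cylinder_mem {C : Set (Set (Setoid ℕ))}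
    (hC : ∀ (n : ℕ) (π : Setoid (Fin n)), π ≠ ⊤ → cylinder n π ∈ C) :
    instMeasurableSpacePartition ≤ MeasurableSpace.generateFrom C := by
  refine iSup_le fun n => ?_
  rintro _ ⟨A, -, rfl⟩
  have h1 : ∀ π : Setoid (Fin n), π ≠ ⊤ →
      MeasurableSet[MeasurableSpace.generateFrom C] (restr n ⁻¹' {π}) :=
    fun π hπ => MeasurableSpace.measurableSet_generateFrom (hC n π hπ)
  have h2 : ∀ π : Setoid (Fin n),
      MeasurableSet[MeasurableSpace.generateFrom C] (restr n ⁻¹' {π}) := by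
    intro π
    by_cases hπ : π = ⊤
    · have : restr n ⁻¹' {π} = (⋃ σ ∈ {σ : Setoid (Fin n) | σ ≠ ⊤}, restr n ⁻¹' {σ})ᶜ := by
        ext x
        simp only [hπ, mem_preimage, mem_singleton_iff, mem_compl_iff, mem_iUnion, exists_prop,
          mem_ofPred_eq, not_exists, not_and]
        exact ⟨fun hx σ hσ h => hσ (h.symm.trans hx), fun hx => by
          by_contra hne
          exact hx _ hne rfl⟩
      rw [this]
      exact (MeasurableSet.biUnion (Set.to_countable _) fun σ hσ => h1 σ hσ).compl
    · exact h1 π hπ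
  have : restr n ⁻¹' A = ⋃ σ ∈ A, restr n ⁻¹' {σ} := by
    ext x
    simp
  rw [this]
  exact MeasurableSet.biUnion (Set.to_countable _) fun σ _ => h2 σ

theorem generateFrom_cylinderRing :
    instMeasurableSpacePartition = MeasurableSpace.generateFrom cylinderRing := by
  refine le_antisymm
    (le_generateFrom_of_cylinder_mem fun n π hπ => cylinder_mem_cylinderRing hπ) ?_
  refine MeasurableSpace.generateFrom_le ?_
  rintro _ ⟨n, A, -, rfl⟩
  exact measurable_restr n trivial

/-- Compactness of the space of partitions: an ultrafilter has a limit. -/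
theorem exists_ultrafilter_limit (U : Ultrafilter (Setoid ℕ)) :
    ∃ x : Setoid ℕ, ∀ n, ∀ᶠ y in (U : Filter (Setoid ℕ)), restr n y = restr n x := by
  have hequiv : Equivalence fun i j => ∀ᶠ y : Setoid ℕ in U, y i j := by
    refine ⟨fun i => Eventually.of_forall fun y => y.refl' i, fun {i j} h => ?_,
      fun {i j k} h h' => ?_⟩
    · filter_upwards [h] with y hy
      exact y.symm' hy
    · filter_upwards [h, h'] with y hy hy'
      exact y.trans' hy hy'
  let x : Setoid ℕ := ⟨fun i j => ∀ᶠ y : Setoid ℕ in U, y i j, hequiv⟩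
  refine ⟨x, fun n => ?_⟩
  have h : ∀ i j : Fin n, ∀ᶠ y in (U : Filter (Setoid ℕ)), y i j ↔ x i j := by
    intro i j
    by_cases hx : ∀ᶠ y in (U : Filter (Setoid ℕ)), y i j
    · exact hx.mono fun y hy => iff_of_true hy hx
    · exact (Ultrafilter.eventually_not.2 hx).mono fun y hy => iff_of_false hy hx
  filter_upwards [eventually_all.2 fun i => eventually_all.2 (h i)] with y hy
  exact Setoid.ext hy

/-- Membership in a set of the ring is decided at a finite level, so it passes to ultrafilter limits
in both directions. Were there no finite subcover, an ultrafilter on the leftover sets would have a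
limit in `S` outside every `f i`. -/
theorem exists_finset_subcover {S : Set (Setoid ℕ)} (hS : S ∈ cylinderRing)
    {f : ℕ → Set (Setoid ℕ)} (hf : ∀ i, f i ∈ cylinderRing) (hSf : S ⊆ ⋃ i, f i) :
    ∃ I : Finset ℕ, S ⊆ ⋃ i ∈ I, f i := by
  classical
  by_contra! hcon
  let F : Filter (Setoid ℕ) := ⨅ I : Finset ℕ, 𝓟 (S \ ⋃ i ∈ I, f i)
  have hF : F.NeBot := by
    refine iInf_neBot_of_directed ?_ fun I => principal_neBot_iff.2 (sdiff_nonempty.2 (hcon I))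
    refine fun I J => ⟨I ∪ J, ?_, ?_⟩
    · exact principal_mono.2 (sdiff_subset_sdiff_right
        (biUnion_subset_biUnion_left fun i hi => Finset.mem_union_left J hi))
    · exact principal_mono.2 (sdiff_subset_sdiff_right
        (biUnion_subset_biUnion_left fun i hi => Finset.mem_union_right I hi))
  have hmem : ∀ I : Finset ℕ, S \ ⋃ i ∈ I, f i ∈ Ultrafilter.of F := fun I =>
    Ultrafilter.of_le F (mem_iInf_of_mem I (mem_principal_self _))
  obtain ⟨x, hx⟩ := exists_ultrafilter_limit (Ultrafilter.of F)
  have key : ∀ T ∈ cylinderRing, (∀ᶠ y in (Ultrafilter.of F : Filter (Setoid ℕ)), y ∈ T ↔ x ∈ T) := by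
    rintro _ ⟨n, A, -, rfl⟩
    filter_upwards [hx n] with y hy
    rw [mem_preimage, mem_preimage, hy]
  have hxS : x ∈ S := by
    obtain ⟨y, hy1, hy2⟩ := ((key S hS).and (hmem ∅)).exists
    exact hy1.1 hy2.1
  obtain ⟨i, hi⟩ := mem_iUnion.1 (hSf hxS)
  obtain ⟨y, hy1, hy2⟩ := ((key _ (hf i)).and (hmem {i})).exists
  exact hy2.2 (mem_biUnion (Finset.mem_coe.2 (Finset.mem_singleton_self i)) (hy1.2 hi))

/-- A limit of measures on the sets that are away from the one-block partition. -/
theorem exists_measure_of_tendsto {ι : Type*} {l : Filter ι} [l.NeBot]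
    (m : ι → Measure (Setoid ℕ)) (c : (n : ℕ) → Setoid (Fin n) → ℝ≥0∞)
    (hc : ∀ (n : ℕ) (π : Setoid (Fin n)), π ≠ ⊤ →
      Tendsto (fun i => m i (cylinder n π)) l (𝓝 (c n π))) :
    ∃ μ : Measure (Setoid ℕ), (∀ (n : ℕ) (π : Setoid (Fin n)), π ≠ ⊤ → μ (cylinder n π) = c n π) ∧
      μ {⊤} = 0 := by
  classical
  -- A set of the ring is a finite disjoint union of cylinders over partitions other than `⊤`.
  have hlim : ∀ S ∈ cylinderRing, ∃ a, Tendsto (fun i => m i S) l (𝓝 a) := by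
    rintro _ ⟨n, A, hA, rfl⟩
    refine ⟨∑ σ ∈ Finset.univ.filter (· ∈ A), c n σ, ?_⟩
    have h1 : ∀ i, m i (restr n ⁻¹' A) = ∑ σ ∈ Finset.univ.filter (· ∈ A), m i (cylinder n σ) := by
      intro i
      have := sum_measure_preimage_singleton (μ := m i) (Finset.univ.filter (· ∈ A)) (f := restr n)
        (fun y _ => measurable_restr n (MeasurableSet.singleton y))
      rw [show restr n ⁻¹' A = restr n ⁻¹' ((Finset.univ.filter (· ∈ A) : Finset _) : Set _) by
        simp, ← this]
      rfl
    simp only [h1]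
    refine tendsto_finsetSum _ fun σ hσ => hc n σ ?_
    rintro rfl
    exact hA (Finset.mem_filter.1 hσ).2
  choose! L hL using hlim
  have hL0 : L ∅ = 0 := by
    refine tendsto_nhds_unique (hL ∅ isSetRing_cylinderRing.empty_mem) ?_
    simp
  let M : AddContent ℝ≥0∞ cylinderRing :=
    isSetRing_cylinderRing.addContent_of_union L hL0 (by
      intro S T hS hT hd
      refine tendsto_nhds_unique (hL _ (isSetRing_cylinderRing.union_mem hS hT)) ?_
      refine ((hL S hS).add (hL T hT)).congr fun i => ?_
      obtain ⟨n, B, -, rfl⟩ := hT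
      rw [measure_union hd (measurable_restr n trivial)])
  -- Compactness reduces the countable union to a finite one, where additivity is enough.
  have hM : M.IsSigmaSubadditive := by
    intro f hf hU
    obtain ⟨I, hI⟩ := exists_finset_subcover hU hf Subset.rfl
    have heq : ⋃ i, f i = ⋃ i ∈ I, f i :=
      Subset.antisymm hI (iUnion₂_subset fun i _ => subset_iUnion f i)
    rw [heq]
    exact (addContent_biUnion_le isSetRing_cylinderRing fun i _ => hf i).trans
      (ENNReal.sum_le_tsum I)
  let μ := M.measure isSetRing_cylinderRing.isSetSemiring generateFrom_cylinderRing.le hM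
  have hsing : MeasurableSet ({⊤} : Set (Setoid ℕ)) := by
    have : ({⊤} : Set (Setoid ℕ)) = ⋂ n, cylinder n ⊤ := by
      ext x
      simp only [mem_singleton_iff, mem_iInter]
      exact ⟨fun h n => h ▸ rfl, fun h => eq_of_restr_eq h⟩
    rw [this]
    exact MeasurableSet.iInter fun n => measurableSet_cylinder n ⊤
  -- No set of the ring contains `⊤`, so the content does not control the mass of that point; it is
  -- removed by restriction.
  refine ⟨μ.restrict {⊤}ᶜ, fun n π hπ => ?_, ?_⟩
  · have hsub : cylinder n π ⊆ {⊤}ᶜ := by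
      rintro x hx rfl
      exact hπ (hx.symm.trans (restr_top n))
    rw [Measure.restrict_apply (measurableSet_cylinder n π), inter_eq_self_of_subset_left hsub]
    have hmem := cylinder_mem_cylinderRing hπ
    rw [AddContent.measure_eq M _ generateFrom_cylinderRing hM hmem]
    exact tendsto_nhds_unique (hL _ hmem) (hc n π hπ)
  · rw [Measure.restrict_apply hsing, inter_compl_self, measure_empty]

/-- A measure that does not charge the one-block partition is determined by its values on the
cylinders, if these are finite. -/
theorem measure_ext_of_cylinder {μ ν : Measure (Setoid ℕ)}
    (h : ∀ (n : ℕ) (π : Setoid (Fin n)), π ≠ ⊤ → μ (cylinder n π) = ν (cylinder n π))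
    (hfin : ∀ (n : ℕ) (π : Setoid (Fin n)), π ≠ ⊤ → μ (cylinder n π) ≠ ∞)
    (hμ : μ {⊤} = 0) (hν : ν {⊤} = 0) : μ = ν := by
  -- Including `{⊤}` makes this a countable cover of the whole space by sets of finite measure. It
  -- is a π-system up to empty intersections, as two cylinders are nested or disjoint.
  let S : Set (Set (Setoid ℕ)) :=
    insert {⊤} (⋃ n : ℕ, (cylinder n) '' {π : Setoid (Fin n) | π ≠ ⊤})
  have hmem : ∀ (n : ℕ) (π : Setoid (Fin n)), π ≠ ⊤ → cylinder n π ∈ S := fun n π hπ =>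
    Or.inr (mem_iUnion.2 ⟨n, π, hπ, rfl⟩)
  have hS : ∀ s ∈ S, s = {⊤} ∨ ∃ (n : ℕ) (π : Setoid (Fin n)), π ≠ ⊤ ∧ s = cylinder n π := by
    rintro s (rfl | hs)
    · exact Or.inl rfl
    · obtain ⟨n, π, hπ, rfl⟩ := mem_iUnion.1 hs
      exact Or.inr ⟨n, π, hπ, rfl⟩
  have htop : ({⊤} : Set (Setoid ℕ)) = ⋂ n, cylinder n ⊤ := by
    ext x
    simp only [mem_singleton_iff, mem_iInter]
    exact ⟨fun h n => h ▸ rfl, fun h => eq_of_restr_eq h⟩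
  have hgen : instMeasurableSpacePartition = MeasurableSpace.generateFrom S := by
    refine le_antisymm (le_generateFrom_of_cylinder_mem hmem) (MeasurableSpace.generateFrom_le ?_)
    intro s hs
    rcases hS s hs with rfl | ⟨n, π, -, rfl⟩
    · rw [htop]
      exact MeasurableSet.iInter fun n => measurableSet_cylinder n ⊤
    · exact measurableSet_cylinder n π
  have hinter : ∀ (n m : ℕ) (π : Setoid (Fin n)) (σ : Setoid (Fin m)), n ≤ m →
      (cylinder n π ∩ cylinder m σ).Nonempty → cylinder n π ∩ cylinder m σ = cylinder m σ := by
    rintro n m π σ hnm ⟨x, hx1, hx2⟩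
    refine inter_eq_self_of_subset_right fun y hy => ?_
    exact (restr_eq_mono hnm ((show restr m y = σ from hy).trans hx2.symm)).trans hx1
  have hpi : IsPiSystem S := by
    intro s hs t ht hne
    rcases hS s hs with rfl | ⟨n, π, hπ, rfl⟩
    · rwa [inter_eq_self_of_subset_left (singleton_subset_iff.2 _)]
      obtain ⟨x, rfl, hx⟩ := hne
      exact hx
    · rcases hS t ht with rfl | ⟨m, σ, hσ, rfl⟩
      · rwa [inter_eq_self_of_subset_right (singleton_subset_iff.2 _)]
        obtain ⟨x, hx, rfl⟩ := hne
        exact hx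
      · rcases le_total n m with hnm | hnm
        · rwa [hinter n m π σ hnm hne]
        · rw [inter_comm] at hne ⊢
          rwa [hinter m n σ π hnm hne]
  refine Measure.ext_of_generateFrom_of_cover_subset hgen hpi Subset.rfl ?_ ?_ ?_ ?_
  · exact (Set.countable_iUnion fun n => (Set.to_countable _).image _).insert _
  · refine eq_univ_of_forall fun x => ?_
    by_cases hx : x = ⊤
    · exact ⟨{⊤}, mem_insert _ _, hx⟩
    · have : ∃ n, restr n x ≠ ⊤ := by
        by_contra! hcon
        exact hx (eq_of_restr_eq hcon)
      obtain ⟨n, hn⟩ := this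
      exact ⟨_, hmem n _ hn, rfl⟩
  · intro s hs
    rcases hS s hs with rfl | ⟨n, π, hπ, rfl⟩
    · rw [hμ]
      exact ENNReal.zero_ne_top
    · exact hfin n π hπ
  · intro s hs
    rcases hS s hs with rfl | ⟨n, π, hπ, rfl⟩
    · rw [hμ, hν]
    · exact h n π hπ

variable {Ω : Type*} [MeasurableSpace Ω] {P : Measure Ω} [IsProbabilityMeasure P]
  {X : ℝ → Ω → Setoid ℕ} {g : ℕ → ℝ → ℝ} {h : (n : ℕ) → Setoid (Fin n) → ℝ → ℝ}

theorem exists_isJumpMeasure (hX : IsFragmentation P X) (hreg : HasRegularJumps P X g h) {t : ℝ}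
    (ht : t ∈ Ico (0 : ℝ) 1) : ∃ μ : Measure (Setoid ℕ), IsJumpMeasure P X g h t μ := by
  refine exists_measure_of_tendsto (l := 𝓝[>] (0 : ℝ))
    (fun s => ENNReal.ofReal s⁻¹ • transitionLaw hX t (t + s)) _ fun n π hπ => ?_
  refine (ENNReal.tendsto_ofReal (tendsto_transitionLaw_cylinder hX hreg hπ ht)).congr' ?_
  filter_upwards [self_mem_nhdsWithin] with s hs
  rw [ENNReal.ofReal_mul (inv_pos.2 hs).le, ofReal_measureReal]
  rfl

theorem IsJumpMeasure.eq_of_jumpRate_eq {Ω' : Type*} [MeasurableSpace Ω'] {P' : Measure Ω'}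
    {X' : ℝ → Ω' → Setoid ℕ} {g' : ℕ → ℝ → ℝ} {h' : (n : ℕ) → Setoid (Fin n) → ℝ → ℝ} {t : ℝ}
    {μ μ' : Measure (Setoid ℕ)} (hμ : IsJumpMeasure P X g h t μ)
    (hμ' : IsJumpMeasure P' X' g' h' t μ')
    (heq : ∀ (n : ℕ) (π : Setoid (Fin n)), π ≠ ⊤ →
      jumpRate P X g h n π t = jumpRate P' X' g' h' n π t) : μ = μ' := by
  refine measure_ext_of_cylinder (fun n π hπ => ?_) (fun n π hπ => ?_) hμ.2 hμ'.2
  · rw [hμ.1 n π hπ, hμ'.1 n π hπ, heq n π hπ]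
  · rw [hμ.1 n π hπ]
    exact ENNReal.ofReal_ne_top

theorem existsUnique_isJumpMeasure (hX : IsFragmentation P X) (hreg : HasRegularJumps P X g h)
    {t : ℝ} (ht : t ∈ Ico (0 : ℝ) 1) : ∃! μ : Measure (Setoid ℕ), IsJumpMeasure P X g h t μ := by
  obtain ⟨μ, hμ⟩ := exists_isJumpMeasure hX hreg ht
  exact ⟨μ, hμ, fun ν hν => hν.eq_of_jumpRate_eq hμ fun _ _ _ => rfl⟩

end JumpMeasure

/-! ### The rates and the law determine each other -/

section Law

variable {Ω : Type*} [MeasurableSpace Ω] {P : Measure Ω} [IsProbabilityMeasure P]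
  {X : ℝ → Ω → Setoid ℕ} {g : ℕ → ℝ → ℝ} {h : (n : ℕ) → Setoid (Fin n) → ℝ → ℝ}
  {Ω' : Type*} [MeasurableSpace Ω'] {P' : Measure Ω'} [IsProbabilityMeasure P']
  {X' : ℝ → Ω' → Setoid ℕ} {g' : ℕ → ℝ → ℝ} {h' : (n : ℕ) → Setoid (Fin n) → ℝ → ℝ}

/-- Start from the one-block state at `s`, split according to the state at `t`, and apply the Markov
property at `t`. -/
theorem chapman_kolmogorov (hX : IsFragmentation P X) (hreg : HasRegularJumps P X g h)
    {s t u : ℝ} (hs : 0 ≤ s) (hst : s ≤ t) (htu : t ≤ u) (hu : u < 1) {n : ℕ} (hn : 2 ≤ n)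
    (π : Setoid (Fin n)) :
    (transitionLaw hX s u).real (cylinder n π) =
      ∑ σ : Setoid (Fin n), (transitionLaw hX s t).real (cylinder n σ) *
        (fragLaw (transitionLaw hX t u) (liftPartition σ)).real (cylinder n π) := by
  have ht0 := hs.trans hst
  have htI : t ∈ Ico (0 : ℝ) 1 := ⟨ht0, htu.trans_lt hu⟩
  rw [transitionLaw_cylinder hX hreg hs (hst.trans htu) hu hn]
  have h1 := sum_cylinder_inter P (Y := fun ω => restr n (X t ω))
    ((measurable_restr n).comp (hX.measurable t htI))
    (X s ⁻¹' cylinder n ⊤ ∩ X u ⁻¹' cylinder n π) Finset.univ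
  rw [Finset.coe_univ, preimage_univ, inter_univ] at h1
  rw [h1, Finset.mul_sum]
  refine Finset.sum_congr rfl fun σ _ => ?_
  rw [transitionLaw_cylinder hX hreg hs hst htI.2 hn, mul_assoc]
  congr 1
  have hA : MeasurableSet[past X t] (X s ⁻¹' cylinder n ⊤ ∩ X t ⁻¹' cylinder n σ) :=
    (measurableSet_past_cylinder hs hst n ⊤).inter (measurableSet_past_cylinder ht0 le_rfl n σ)
  rw [← measure_past_inter_cylinder hX ht0 htu hu hA (by
    rw [restr_liftPartition]; exact inter_subset_right) π]
  congr 1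
  exact inter_right_comm _ _ _

/-- Continuity in probability: the state on `[n]` differs at two nearby times only with small
probability. -/
theorem continuousOn_transitionLaw_cylinder (hX : IsFragmentation P X)
    (hreg : HasRegularJumps P X g h) {s : ℝ} (hs : 0 ≤ s) {n : ℕ} (hn : 2 ≤ n)
    (π : Setoid (Fin n)) :
    ContinuousOn (fun u => (transitionLaw hX s u).real (cylinder n π)) (Ico s 1) := by
  have hsub : Ico s 1 ⊆ Ico 0 1 := Ico_subset_Ico_left hs
  have hcont : ContinuousOn
      (fun u => (jumpTail P X n s)⁻¹ * P.real (X s ⁻¹' cylinder n ⊤ ∩ X u ⁻¹' cylinder n π))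
      (Ico s 1) := by
    refine continuousOn_const.mul fun u hu => ?_
    have h0 := hX.continuous_in_probability u (hsub hu) (1 / ((n + 1 : ℕ) : ℝ)) (by positivity)
    have h1 : Tendsto (fun v => P.real {ω | 1 / ((n + 1 : ℕ) : ℝ) ≤ partDist (X v ω) (X u ω)})
        (𝓝[Ico s 1] u) (𝓝 0) := by
      have := (ENNReal.tendsto_toReal ENNReal.zero_ne_top).comp (h0.mono_left (nhdsWithin_mono u hsub))
      exact this
    refine tendsto_iff_dist_tendsto_zero.2 (squeeze_zero (fun _ => dist_nonneg) (fun v => ?_) h1)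
    have key : ∀ a b : ℝ, (∀ ω, 1 / ((n + 1 : ℕ) : ℝ) ≤ partDist (X v ω) (X u ω) ∨
        restr n (X a ω) = restr n (X b ω)) →
        P.real (X s ⁻¹' cylinder n ⊤ ∩ X a ⁻¹' cylinder n π) -
          P.real (X s ⁻¹' cylinder n ⊤ ∩ X b ⁻¹' cylinder n π) ≤
          P.real {ω | 1 / ((n + 1 : ℕ) : ℝ) ≤ partDist (X v ω) (X u ω)} := by
      intro a b hab
      have h2 : P.real (X s ⁻¹' cylinder n ⊤ ∩ X a ⁻¹' cylinder n π) ≤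
          P.real ((X s ⁻¹' cylinder n ⊤ ∩ X b ⁻¹' cylinder n π) ∪
            {ω | 1 / ((n + 1 : ℕ) : ℝ) ≤ partDist (X v ω) (X u ω)}) := by
        refine measureReal_mono fun ω hω => ?_
        rcases hab ω with h3 | h3
        · exact Or.inr h3
        · exact Or.inl ⟨hω.1, h3.symm.trans hω.2⟩
      have h3 := measureReal_union_le (μ := P) (X s ⁻¹' cylinder n ⊤ ∩ X b ⁻¹' cylinder n π)
        {ω | 1 / ((n + 1 : ℕ) : ℝ) ≤ partDist (X v ω) (X u ω)}
      linarith
    have hor : ∀ ω, 1 / ((n + 1 : ℕ) : ℝ) ≤ partDist (X v ω) (X u ω) ∨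
        restr n (X v ω) = restr n (X u ω) := by
      intro ω
      refine or_iff_not_imp_left.2 fun hlt => ?_
      exact restr_eq_mono (by omega) ((partDist_lt_iff (by omega)).1 (not_le.1 hlt))
    exact abs_sub_le_iff.2 ⟨key v u hor, key u v fun ω => (hor ω).imp_right Eq.symm⟩
  refine hcont.congr fun u hu => ?_
  exact transitionLaw_cylinder hX hreg hs hu.1 hu.2 hn π

/-- The `ℓ¹` distance between the laws of the restrictions to `[n]` under two measures. -/
noncomputable def cylinderDist (n : ℕ) (ν ν' : Measure (Setoid ℕ)) : ℝ :=
  ∑ σ : Setoid (Fin n), |ν.real (cylinder n σ) - ν'.real (cylinder n σ)|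

theorem cylinderDist_nonneg (n : ℕ) (ν ν' : Measure (Setoid ℕ)) : 0 ≤ cylinderDist n ν ν' :=
  Finset.sum_nonneg fun _ _ => abs_nonneg _

/-- Changing the initial law costs no factor, since a stochastic kernel contracts the `ℓ¹` distance;
changing the kernel costs the Lipschitz bound for each target state. The coefficient one of the
first term makes a Gronwall argument unnecessary. -/
theorem cylinderDist_transitionLaw_le (hX : IsFragmentation P X) (hreg : HasRegularJumps P X g h)
    (hX' : IsFragmentation P' X') (hreg' : HasRegularJumps P' X' g' h') {n : ℕ} (hn : 2 ≤ n)
    {s t u : ℝ} (hs : 0 ≤ s) (hst : s ≤ t) (htu : t ≤ u) (hu : u < 1) :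
    cylinderDist n (transitionLaw hX s u) (transitionLaw hX' s u) ≤
      cylinderDist n (transitionLaw hX s t) (transitionLaw hX' s t) +
        Fintype.card (Setoid (Fin n)) *
          (n * cylinderDist n (transitionLaw hX t u) (transitionLaw hX' t u)) := by
  set E := cylinderDist n (transitionLaw hX t u) (transitionLaw hX' t u) with hE
  let p : Setoid (Fin n) → ℝ := fun σ => (transitionLaw hX s t).real (cylinder n σ)
  let p' : Setoid (Fin n) → ℝ := fun σ => (transitionLaw hX' s t).real (cylinder n σ)
  let K : Setoid (Fin n) → Setoid (Fin n) → ℝ := fun σ π =>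
    (fragLaw (transitionLaw hX t u) (liftPartition σ)).real (cylinder n π)
  let K' : Setoid (Fin n) → Setoid (Fin n) → ℝ := fun σ π =>
    (fragLaw (transitionLaw hX' t u) (liftPartition σ)).real (cylinder n π)
  have hterm : ∀ π : Setoid (Fin n), |(transitionLaw hX s u).real (cylinder n π) -
      (transitionLaw hX' s u).real (cylinder n π)| ≤
      ∑ σ, |p σ - p' σ| * K σ π + n * E := by
    intro π
    rw [chapman_kolmogorov hX hreg hs hst htu hu hn π,
      chapman_kolmogorov hX' hreg' hs hst htu hu hn π, ← Finset.sum_sub_distrib]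
    have h1 : ∑ σ, p' σ * (n * E) = n * E := by
      rw [← Finset.sum_mul, sum_cylinder_univ, one_mul]
    rw [← h1, ← Finset.sum_add_distrib]
    refine (Finset.abs_sum_le_sum_abs _ _).trans (Finset.sum_le_sum fun σ _ => ?_)
    change |p σ * K σ π - p' σ * K' σ π| ≤ _
    have h2 : p σ * K σ π - p' σ * K' σ π = (p σ - p' σ) * K σ π + p' σ * (K σ π - K' σ π) := by
      ring
    rw [h2]
    refine (abs_add_le _ _).trans (add_le_add ?_ ?_)
    · rw [abs_mul, abs_of_nonneg (measureReal_nonneg : 0 ≤ K σ π)]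
    · rw [abs_mul, abs_of_nonneg (measureReal_nonneg : 0 ≤ p' σ)]
      exact mul_le_mul_of_nonneg_left (abs_fragLaw_cylinder_sub_le _ _ _ _) measureReal_nonneg
  refine (Finset.sum_le_sum fun π _ => hterm π).trans (le_of_eq ?_)
  rw [Finset.sum_add_distrib, Finset.sum_const, Finset.card_univ, nsmul_eq_mul, Finset.sum_comm]
  congr 1
  refine Finset.sum_congr rfl fun σ _ => ?_
  rw [← Finset.mul_sum, sum_cylinder_univ, mul_one]

theorem tendsto_cylinderDist_transitionLaw (hX : IsFragmentation P X)
    (hreg : HasRegularJumps P X g h) (hX' : IsFragmentation P' X')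
    (hreg' : HasRegularJumps P' X' g' h') {n : ℕ} {t : ℝ} (ht : t ∈ Ico (0 : ℝ) 1)
    (heq : ∀ π : Setoid (Fin n), π ≠ ⊤ →
      jumpRate P X g h n π t = jumpRate P' X' g' h' n π t) :
    Tendsto (fun s : ℝ => s⁻¹ *
      cylinderDist n (transitionLaw hX t (t + s)) (transitionLaw hX' t (t + s)))
      (𝓝[>] 0) (𝓝 0) := by
  classical
  let δ : ℝ → Setoid (Fin n) → ℝ := fun s σ => (transitionLaw hX t (t + s)).real (cylinder n σ) -
    (transitionLaw hX' t (t + s)).real (cylinder n σ)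
  have h1 : ∀ σ ∈ Finset.univ.erase (⊤ : Setoid (Fin n)),
      Tendsto (fun s : ℝ => |s⁻¹ * δ s σ|) (𝓝[>] 0) (𝓝 0) := by
    intro σ hσ
    have hσ' := Finset.ne_of_mem_erase hσ
    have := (tendsto_transitionLaw_cylinder hX hreg hσ' ht).sub
      (tendsto_transitionLaw_cylinder hX' hreg' hσ' ht)
    rw [heq σ hσ', sub_self] at this
    have h2 := this.abs
    rw [abs_zero] at h2
    refine h2.congr fun s => ?_
    rw [← mul_sub]
  have h2 := (tendsto_finsetSum _ h1).const_mul 2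
  -- The factor `2` pays for the state `⊤`, which has no rate: both laws have total mass one, so its
  -- discrepancy is at most the sum of the others.
  rw [Finset.sum_const_zero, mul_zero] at h2
  refine squeeze_zero' ?_ ?_ h2
  · filter_upwards [self_mem_nhdsWithin] with s hs
    exact mul_nonneg (inv_pos.2 (mem_Ioi.1 hs)).le (cylinderDist_nonneg _ _ _)
  · filter_upwards [self_mem_nhdsWithin] with s hs
    have hs' := (inv_pos.2 (mem_Ioi.1 hs)).le
    have h3 : ∑ σ, δ s σ = 0 := by
      rw [Finset.sum_sub_distrib, sum_cylinder_univ, sum_cylinder_univ, sub_self]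
    rw [← Finset.add_sum_erase _ _ (Finset.mem_univ ⊤)] at h3
    have h4 : |δ s ⊤| ≤ ∑ σ ∈ Finset.univ.erase ⊤, |δ s σ| := by
      rw [eq_neg_of_add_eq_zero_left h3, abs_neg]
      exact Finset.abs_sum_le_sum_abs _ _
    have h5 : cylinderDist n (transitionLaw hX t (t + s)) (transitionLaw hX' t (t + s)) ≤
        2 * ∑ σ ∈ Finset.univ.erase ⊤, |δ s σ| := by
      unfold cylinderDist
      rw [← Finset.add_sum_erase _ _ (Finset.mem_univ ⊤)]
      change |δ s ⊤| + ∑ σ ∈ Finset.univ.erase ⊤, |δ s σ| ≤ _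
      linarith
    refine (mul_le_mul_of_nonneg_left h5 hs').trans (le_of_eq ?_)
    simp only [abs_mul, abs_of_nonneg hs', ← Finset.mul_sum]
    ring

theorem cylinderDist_transitionLaw_self (hX : IsFragmentation P X) (hreg : HasRegularJumps P X g h)
    (hX' : IsFragmentation P' X') (hreg' : HasRegularJumps P' X' g' h') {n : ℕ} (hn : 2 ≤ n)
    {s : ℝ} (hs : s ∈ Ico (0 : ℝ) 1) :
    cylinderDist n (transitionLaw hX s s) (transitionLaw hX' s s) = 0 := by
  refine Finset.sum_eq_zero fun σ _ => ?_
  rw [abs_eq_zero, sub_eq_zero]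
  by_cases hσ : σ = ⊤
  · subst hσ
    rw [transitionLaw_cylinder_top hX hreg hs.1 le_rfl hs.2 hn,
      transitionLaw_cylinder_top hX' hreg' hs.1 le_rfl hs.2 hn,
      inv_mul_cancel₀ (hreg.tail_pos n hn s hs).ne', inv_mul_cancel₀ (hreg'.tail_pos n hn s hs).ne']
  · have hempty : cylinder n ⊤ ∩ cylinder n σ = ∅ := by
      ext x
      simp only [mem_inter_iff, mem_empty_iff_false, iff_false, not_and]
      exact fun h1 h2 => hσ (h2.symm.trans h1)
    rw [transitionLaw_cylinder hX hreg hs.1 le_rfl hs.2 hn,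
      transitionLaw_cylinder hX' hreg' hs.1 le_rfl hs.2 hn, ← preimage_inter, ← preimage_inter,
      hempty, preimage_empty, preimage_empty, measureReal_empty, measureReal_empty, mul_zero,
      mul_zero]

/-- The jump rates determine the transition probabilities. -/
theorem cylinderDist_transitionLaw_eq_zero (hX : IsFragmentation P X)
    (hreg : HasRegularJumps P X g h) (hX' : IsFragmentation P' X')
    (hreg' : HasRegularJumps P' X' g' h') {n : ℕ} (hn : 2 ≤ n)
    (heq : ∀ t ∈ Ico (0 : ℝ) 1, ∀ π : Setoid (Fin n), π ≠ ⊤ →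
      jumpRate P X g h n π t = jumpRate P' X' g' h' n π t)
    {s u : ℝ} (hs : 0 ≤ s) (hsu : s ≤ u) (hu : u < 1) :
    cylinderDist n (transitionLaw hX s u) (transitionLaw hX' s u) = 0 := by
  refine le_antisymm ?_ (cylinderDist_nonneg _ _ _)
  let D : ℝ → ℝ := fun v => cylinderDist n (transitionLaw hX s v) (transitionLaw hX' s v)
  have hsub : Icc s u ⊆ Ico s 1 := fun x hx => ⟨hx.1, hx.2.trans_lt hu⟩
  have hcont : ContinuousOn D (Icc s u) := by
    refine ContinuousOn.mono ?_ hsub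
    refine continuousOn_finsetSum _ fun σ _ => ContinuousOn.abs ?_
    exact (continuousOn_transitionLaw_cylinder hX hreg hs hn σ).sub
      (continuousOn_transitionLaw_cylinder hX' hreg' hs hn σ)
  -- Comparison with the zero function: the increment of `D` over `[x, z]` is at most a constant
  -- times a distance that is `o(z - x)` by equality of the rates at `x`.
  refine image_le_of_liminf_slope_right_le_deriv_boundary (f := D) (B := fun _ => 0)
    (B' := fun _ => 0) hcont
    (cylinderDist_transitionLaw_self hX hreg hX' hreg' hn ⟨hs, hsu.trans_lt hu⟩).le
    continuousOn_const (fun x _ => hasDerivWithinAt_const x _ _) ?_ ⟨hsu, le_rfl⟩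
  intro x hx r hr
  have hx' : x ∈ Ico (0 : ℝ) 1 := ⟨hs.trans hx.1, hx.2.trans hu⟩
  have h1 := ((tendsto_cylinderDist_transitionLaw hX hreg hX' hreg' hx' (heq x hx')).const_mul
    (n : ℝ)).const_mul (Fintype.card (Setoid (Fin n)) : ℝ)
  rw [mul_zero, mul_zero] at h1
  have hmap : Tendsto (fun z : ℝ => z - x) (𝓝[>] x) (𝓝[>] 0) := by
    refine tendsto_nhdsWithin_iff.2 ⟨?_, ?_⟩
    · have : Tendsto (fun z : ℝ => z - x) (𝓝 x) (𝓝 (x - x)) := tendsto_id.sub_const x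
      rw [sub_self] at this
      exact this.mono_left nhdsWithin_le_nhds
    · filter_upwards [self_mem_nhdsWithin] with z hz
      exact sub_pos.2 (mem_Ioi.1 hz)
  refine Eventually.frequently ?_
  filter_upwards [(h1.comp hmap).eventually_lt_const hr, Ioo_mem_nhdsGT hx'.2] with z hz hz1
  refine lt_of_le_of_lt ?_ hz
  have hpos : 0 < (z - x)⁻¹ := inv_pos.2 (sub_pos.2 hz1.1)
  have h2 := cylinderDist_transitionLaw_le hX hreg hX' hreg' hn hs hx.1 hz1.1.le hz1.2
  rw [slope_def_field, div_eq_inv_mul, Function.comp_apply, add_sub_cancel]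
  calc (z - x)⁻¹ * (D z - D x) ≤ (z - x)⁻¹ * (Fintype.card (Setoid (Fin n)) *
          (n * cylinderDist n (transitionLaw hX x z) (transitionLaw hX' x z))) :=
        mul_le_mul_of_nonneg_left (by linarith [h2]) hpos.le
    _ = _ := by ring

theorem fragLaw_transitionLaw_eq {n : ℕ} (hX : IsFragmentation P X) (hX' : IsFragmentation P' X')
    {s u : ℝ} (hD : cylinderDist n (transitionLaw hX s u) (transitionLaw hX' s u) = 0)
    (x : Setoid ℕ) (π : Setoid (Fin n)) :
    (fragLaw (transitionLaw hX s u) x).real (cylinder n π) =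
      (fragLaw (transitionLaw hX' s u) x).real (cylinder n π) := by
  have h1 := abs_fragLaw_cylinder_sub_le (transitionLaw hX s u) (transitionLaw hX' s u) x π
  rw [show ∑ σ : Setoid (Fin n), |(transitionLaw hX s u).real (cylinder n σ) -
    (transitionLaw hX' s u).real (cylinder n σ)| = 0 from hD, mul_zero] at h1
  exact sub_eq_zero.1 (abs_nonpos_iff.1 h1)

/-! ### From transition probabilities to laws on the path space, and back -/

theorem measure_cylinder_eq_transitionLaw (hX : IsFragmentation P X) (hX0 : IsStandard P X)
    {u : ℝ} (hu : u ∈ Ico (0 : ℝ) 1) {n : ℕ} (π : Setoid (Fin n)) :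
    P.real (X u ⁻¹' cylinder n π) = (fragLaw (transitionLaw hX 0 u) ⊤).real (cylinder n π) := by
  have h1 := measure_cylinder_top_inter hX le_rfl hu.1 hu.2 π
  have h2 : P.real (X 0 ⁻¹' cylinder n ⊤) = 1 := by
    have : P.real (X 0 ⁻¹' cylinder n ⊤) = P.real univ := by
      refine measureReal_congr (eventuallyEq_set.2 ?_)
      filter_upwards [hX0] with ω hω
      exact iff_of_true (by rw [mem_preimage, hω]; rfl) trivial
    rw [this, probReal_univ]
  have h3 : P.real (X 0 ⁻¹' cylinder n ⊤ ∩ X u ⁻¹' cylinder n π) = P.real (X u ⁻¹' cylinder n π) := by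
    refine measureReal_congr (eventuallyEq_set.2 ?_)
    filter_upwards [hX0] with ω hω
    exact and_iff_right (by rw [mem_preimage, hω]; rfl)
  rw [← h3, h1, h2, one_mul, fragLaw_top]

theorem measurableSet_past_biInter {n : ℕ} {I : Finset (Ico (0 : ℝ) 1)} (hI : I.Nonempty)
    (σ : Ico (0 : ℝ) 1 → Setoid (Fin n)) :
    MeasurableSet[past X (I.max' hI)] (⋂ t ∈ I, X t ⁻¹' cylinder n (σ t)) :=
  Finset.measurableSet_biInter I fun v hv =>
    measurableSet_past_cylinder v.2.1 (I.le_max' v hv) n (σ v)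

theorem biInter_cylinder_subset {n : ℕ} {I : Finset (Ico (0 : ℝ) 1)} {t : Ico (0 : ℝ) 1}
    (ht : t ∈ I) (σ : Ico (0 : ℝ) 1 → Setoid (Fin n)) :
    (⋂ t ∈ I, X t ⁻¹' cylinder n (σ t)) ⊆
      X t ⁻¹' cylinder n (restr n (liftPartition (σ t))) := by
  rw [restr_liftPartition]
  exact biInter_subset_of_mem ht

/-- Induction on the largest time: the Markov property at the preceding time peels off one
transition factor, and the standard initial state handles a single time. -/
theorem finite_dimensional_eq (hX : IsFragmentation P X) (hX0 : IsStandard P X)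
    (hX' : IsFragmentation P' X') (hX0' : IsStandard P' X') {n : ℕ}
    (hD : ∀ s u : ℝ, 0 ≤ s → s ≤ u → u < 1 →
      cylinderDist n (transitionLaw hX s u) (transitionLaw hX' s u) = 0)
    (I : Finset (Ico (0 : ℝ) 1)) (σ : Ico (0 : ℝ) 1 → Setoid (Fin n)) :
    P.real (⋂ t ∈ I, X t ⁻¹' cylinder n (σ t)) = P'.real (⋂ t ∈ I, X' t ⁻¹' cylinder n (σ t)) := by
  induction I using Finset.induction_on_max with
  | empty => simp
  | insert u I hI ih =>
    rw [Finset.set_biInter_insert, Finset.set_biInter_insert]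
    rcases I.eq_empty_or_nonempty with rfl | hne
    · simp only [Finset.notMem_empty, iInter_of_empty, iInter_univ, inter_univ]
      rw [measure_cylinder_eq_transitionLaw hX hX0 u.2, measure_cylinder_eq_transitionLaw hX' hX0' u.2]
      exact fragLaw_transitionLaw_eq hX hX' (hD 0 u le_rfl u.2.1 u.2.2) _ _
    · set t := I.max' hne with ht
      have htI : t ∈ I := I.max'_mem hne
      have htu : (t : ℝ) ≤ u := (hI t htI).le
      rw [inter_comm, inter_comm (X' u ⁻¹' _),
        measure_past_inter_cylinder hX t.2.1 htu u.2.2 (measurableSet_past_biInter hne σ)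
          (biInter_cylinder_subset htI σ) (σ u),
        measure_past_inter_cylinder hX' t.2.1 htu u.2.2 (measurableSet_past_biInter hne σ)
          (biInter_cylinder_subset htI σ) (σ u), ih,
        fragLaw_transitionLaw_eq hX hX' (hD t u t.2.1 htu u.2.2)]

theorem measurable_process (hX : IsFragmentation P X) :
    Measurable fun ω (t : Ico (0 : ℝ) 1) => X t ω :=
  measurable_pi_iff.2 fun t => hX.measurable t t.2

theorem isProbabilityMeasure_processLaw (hX : IsFragmentation P X) :
    IsProbabilityMeasure (processLaw P X) :=
  Measure.isProbabilityMeasure_map (measurable_process hX).aemeasurable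

/-- The restriction to `[n]` of a path. -/
def restrPath (n : ℕ) (f : Ico (0 : ℝ) 1 → Setoid ℕ) : Ico (0 : ℝ) 1 → Setoid (Fin n) :=
  fun t => restr n (f t)

theorem measurable_restrPath (n : ℕ) : Measurable (restrPath n) :=
  measurable_pi_iff.2 fun t => (measurable_restr n).comp (measurable_pi_apply t)

open Classical in
theorem preimage_restrict_restrPath {n : ℕ} (I : Finset (Ico (0 : ℝ) 1))
    (τ : I → Setoid (Fin n)) :
    (I.restrict ∘ restrPath n ∘ fun ω (t : Ico (0 : ℝ) 1) => X t ω) ⁻¹' {τ} =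
      ⋂ t ∈ I, X t ⁻¹' cylinder n (if ht : t ∈ I then τ ⟨t, ht⟩ else ⊤) := by
  ext ω
  simp only [mem_preimage, mem_singleton_iff, mem_iInter, funext_iff]
  constructor
  · intro h t ht
    rw [dif_pos ht]
    exact h ⟨t, ht⟩
  · intro h t
    have := h t t.2
    rw [dif_pos t.2] at this
    exact this

theorem map_restrPath_processLaw_eq (hX : IsFragmentation P X) (hX0 : IsStandard P X)
    (hX' : IsFragmentation P' X') (hX0' : IsStandard P' X') {n : ℕ}
    (hD : ∀ s u : ℝ, 0 ≤ s → s ≤ u → u < 1 →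
      cylinderDist n (transitionLaw hX s u) (transitionLaw hX' s u) = 0) :
    (processLaw P X).map (restrPath n) = (processLaw P' X').map (restrPath n) := by
  classical
  have hm := (measurable_restrPath n).comp (measurable_process hX)
  have hm' := (measurable_restrPath n).comp (measurable_process hX')
  unfold processLaw
  rw [Measure.map_map (measurable_restrPath n) (measurable_process hX),
    Measure.map_map (measurable_restrPath n) (measurable_process hX')]
  have hp : IsProbabilityMeasure (P.map (restrPath n ∘ fun ω (t : Ico (0 : ℝ) 1) => X t ω)) :=
    Measure.isProbabilityMeasure_map hm.aemeasurable
  -- Both laws are projective limits of one family of finite-dimensional marginals, which live on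
  -- finite discrete spaces and may be compared on singletons.
  refine IsProjectiveLimit.unique (P := fun I : Finset (Ico (0 : ℝ) 1) =>
    (P.map (restrPath n ∘ fun ω (t : Ico (0 : ℝ) 1) => X t ω)).map I.restrict)
    (fun I => rfl) fun I => ?_
  have hr : Measurable (I.restrict (π := fun _ => Setoid (Fin n))) := by fun_prop
  change _ = Measure.map _ (Measure.map _ P)
  rw [Measure.map_map hr hm', Measure.map_map hr hm]
  refine Measure.ext_of_singleton fun τ => ?_
  rw [Measure.map_apply (hr.comp hm') (measurableSet_singleton τ),
    Measure.map_apply (hr.comp hm) (measurableSet_singleton τ)]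
  rw [preimage_restrict_restrPath, preimage_restrict_restrPath,
    ← ofReal_measureReal (measure_ne_top P' _), ← ofReal_measureReal (measure_ne_top P _)]
  exact congrArg _ (finite_dimensional_eq hX hX0 hX' hX0' hD I _).symm

/-- Two laws on the path space with the same images under all restrictions to `[n]` coincide. -/
theorem ext_of_map_restrPath {μ ν : Measure (Ico (0 : ℝ) 1 → Setoid ℕ)} [IsProbabilityMeasure μ]
    [IsProbabilityMeasure ν] (h : ∀ n, 2 ≤ n → μ.map (restrPath n) = ν.map (restrPath n)) :
    μ = ν := by
  let C : Set (Set (Ico (0 : ℝ) 1 → Setoid ℕ)) :=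
    {S | ∃ n, 2 ≤ n ∧ ∃ A, MeasurableSet A ∧ S = restrPath n ⁻¹' A}
  have hlift : ∀ {m n : ℕ}, m ≤ n → ∀ {A : Set (Ico (0 : ℝ) 1 → Setoid (Fin m))}, MeasurableSet A →
      ∃ B : Set (Ico (0 : ℝ) 1 → Setoid (Fin n)), MeasurableSet B ∧
        restrPath m ⁻¹' A = restrPath n ⁻¹' B := by
    intro m n hmn A hA
    refine ⟨(fun f t => restrFin hmn (f t)) ⁻¹' A, ?_, rfl⟩
    refine (measurable_pi_iff.2 fun t => ?_) hA
    exact (measurable_of_finite (restrFin hmn)).comp (measurable_pi_apply t)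
  refine ext_of_generate_finite C ?_ ?_ ?_ (by rw [measure_univ, measure_univ])
  · refine le_antisymm (iSup_le fun t => ?_) (MeasurableSpace.generateFrom_le ?_)
    · refine MeasurableSpace.comap_le_iff_le_map.2 (iSup_le fun n => ?_)
      rintro _ ⟨A, -, rfl⟩
      -- Lifting to level `n + 2` meets the condition `2 ≤ n` in `C`.
      refine MeasurableSpace.measurableSet_generateFrom ⟨n + 2, by omega, ?_⟩
      exact hlift (Nat.le_add_right n 2) (A := (fun f => f t) ⁻¹' A)
        (measurable_pi_apply t trivial)
    · rintro _ ⟨n, -, A, hA, rfl⟩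
      exact measurable_restrPath n hA
  · rintro _ ⟨n, hn, A, hA, rfl⟩ _ ⟨m, hm, B, hB, rfl⟩ -
    obtain ⟨A', hA', hAeq⟩ := hlift (le_max_left n m) hA
    obtain ⟨B', hB', hBeq⟩ := hlift (le_max_right n m) hB
    exact ⟨max n m, hn.trans (le_max_left n m), A' ∩ B', hA'.inter hB', by
      rw [hAeq, hBeq, preimage_inter]⟩
  · rintro _ ⟨n, hn, A, hA, rfl⟩
    rw [← Measure.map_apply (measurable_restrPath n) hA, h n hn,
      Measure.map_apply (measurable_restrPath n) hA]

theorem processLaw_eq_of_jumpRate_eq (hX : IsFragmentation P X) (hX0 : IsStandard P X)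
    (hreg : HasRegularJumps P X g h) (hX' : IsFragmentation P' X') (hX0' : IsStandard P' X')
    (hreg' : HasRegularJumps P' X' g' h')
    (heq : ∀ t ∈ Ico (0 : ℝ) 1, ∀ (n : ℕ) (π : Setoid (Fin n)), π ≠ ⊤ →
      jumpRate P X g h n π t = jumpRate P' X' g' h' n π t) :
    processLaw P X = processLaw P' X' := by
  have := isProbabilityMeasure_processLaw hX
  have := isProbabilityMeasure_processLaw hX'
  refine ext_of_map_restrPath fun n hn => map_restrPath_processLaw_eq hX hX0 hX' hX0' ?_
  exact fun s u => cylinderDist_transitionLaw_eq_zero hX hreg hX' hreg' hn fun t ht => heq t ht n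

theorem measure_eq_of_processLaw_eq (hX : IsFragmentation P X) (hX' : IsFragmentation P' X')
    (hlaw : processLaw P X = processLaw P' X') {s u : ℝ} (hs : s ∈ Ico (0 : ℝ) 1)
    (hu : u ∈ Ico (0 : ℝ) 1) {A B : Set (Setoid ℕ)} (hA : MeasurableSet A) (hB : MeasurableSet B) :
    P.real (X s ⁻¹' A ∩ X u ⁻¹' B) = P'.real (X' s ⁻¹' A ∩ X' u ⁻¹' B) := by
  have hm : MeasurableSet
      {f : Ico (0 : ℝ) 1 → Setoid ℕ | f ⟨s, hs⟩ ∈ A ∧ f ⟨u, hu⟩ ∈ B} :=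
    (measurableSet_preimage (measurable_pi_apply (⟨s, hs⟩ : Ico (0 : ℝ) 1)) hA).inter
      (measurableSet_preimage (measurable_pi_apply (⟨u, hu⟩ : Ico (0 : ℝ) 1)) hB)
  have h1 := congrArg
    (fun μ => μ.real {f : Ico (0 : ℝ) 1 → Setoid ℕ | f ⟨s, hs⟩ ∈ A ∧ f ⟨u, hu⟩ ∈ B}) hlaw
  simp only [processLaw] at h1
  rw [map_measureReal_apply (measurable_process hX) hm,
    map_measureReal_apply (measurable_process hX') hm] at h1
  exact h1

/-- The functions `g` and `h` may be different data for the two processes; the rates are compared as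
limits of quotients of two-time probabilities, which the law determines. -/
theorem jumpRate_eq_of_processLaw_eq (hX : IsFragmentation P X) (hreg : HasRegularJumps P X g h)
    (hX' : IsFragmentation P' X') (hreg' : HasRegularJumps P' X' g' h')
    (hlaw : processLaw P X = processLaw P' X') {t : ℝ} (ht : t ∈ Ico (0 : ℝ) 1) {n : ℕ}
    {π : Setoid (Fin n)} (hπ : π ≠ ⊤) :
    jumpRate P X g h n π t = jumpRate P' X' g' h' n π t := by
  have hn := two_le_of_ne_top hπ
  refine tendsto_nhds_unique (tendsto_transitionLaw_cylinder hX hreg hπ ht)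
    ((tendsto_transitionLaw_cylinder hX' hreg' hπ ht).congr' ?_)
  filter_upwards [eventually_add_lt_one ht.2] with s hs
  have hts : t ≤ t + s := by linarith
  have h1 := measure_eq_of_processLaw_eq hX hX' hlaw ht ht (measurableSet_cylinder n ⊤)
    (measurableSet_cylinder n ⊤)
  rw [inter_self, inter_self, ← jumpTail_eq hX hreg hn ht, ← jumpTail_eq hX' hreg' hn ht] at h1
  rw [transitionLaw_cylinder hX hreg ht.1 hts hs.2 hn,
    transitionLaw_cylinder hX' hreg' ht.1 hts hs.2 hn, h1,
    measure_eq_of_processLaw_eq hX hX' hlaw ht ⟨ht.1.trans hts, hs.2⟩ (measurableSet_cylinder n ⊤)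
      (measurableSet_cylinder n π)]

theorem IsJumpMeasure.jumpRate_eq (hreg : HasRegularJumps P X g h)
    (hreg' : HasRegularJumps P' X' g' h') {t : ℝ} (ht : t ∈ Ico (0 : ℝ) 1)
    {μ : Measure (Setoid ℕ)} (hμ : IsJumpMeasure P X g h t μ)
    (hμ' : IsJumpMeasure P' X' g' h' t μ) {n : ℕ} {π : Setoid (Fin n)} (hπ : π ≠ ⊤) :
    jumpRate P X g h n π t = jumpRate P' X' g' h' n π t :=
  (ENNReal.ofReal_eq_ofReal_iff (jumpRate_nonneg hreg hπ ht) (jumpRate_nonneg hreg' hπ ht)).1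
    ((hμ.1 n π hπ).symm.trans (hμ'.1 n π hπ))

end Law

end InhomFrag

open InhomFrag in
theorem proposition3p2 {Ω : Type*} [MeasurableSpace Ω] (P : Measure Ω) [IsProbabilityMeasure P]
    (X : ℝ → Ω → Setoid ℕ) (g : ℕ → ℝ → ℝ) (h : (n : ℕ) → Setoid (Fin n) → ℝ → ℝ)
    (hX : IsFragmentation P X) (hX0 : IsStandard P X) (hreg : HasRegularJumps P X g h) :
    -- the jump rates are the limits that they stand for
    (∀ t ∈ Ico (0 : ℝ) 1, ∀ (n : ℕ) (π : Setoid (Fin n)), π ≠ ⊤ →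
      Tendsto (fun s : ℝ => s⁻¹ * (ProbabilityTheory.cond P {ω | t ≤ firstJump X n ω}).real
          {ω | restr n (X (firstJump X n ω) ω) = π ∧ firstJump X n ω ∈ Icc t (t + s)})
        (𝓝[>] 0) (𝓝 (jumpRate P X g h n π t))) ∧
    -- existence and uniqueness of the measure at each time
    (∀ t ∈ Ico (0 : ℝ) 1, ∃! μ : Measure (Setoid ℕ), IsJumpMeasure P X g h t μ) ∧
    -- the family of measures characterizes the law
    (∀ {Ω' : Type*} [MeasurableSpace Ω'] (P' : Measure Ω') [IsProbabilityMeasure P']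
      (X' : ℝ → Ω' → Setoid ℕ) (g' : ℕ → ℝ → ℝ) (h' : (n : ℕ) → Setoid (Fin n) → ℝ → ℝ),
      IsFragmentation P' X' → IsStandard P' X' → HasRegularJumps P' X' g' h' →
      ∀ μ μ' : ℝ → Measure (Setoid ℕ),
        (∀ t ∈ Ico (0 : ℝ) 1, IsJumpMeasure P X g h t (μ t)) →
        (∀ t ∈ Ico (0 : ℝ) 1, IsJumpMeasure P' X' g' h' t (μ' t)) →
        ((∀ t ∈ Ico (0 : ℝ) 1, μ t = μ' t) ↔ processLaw P X = processLaw P' X')) := by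
  refine ⟨fun t ht n π hπ => tendsto_cond_firstJump hX hreg hπ ht,
    fun t ht => existsUnique_isJumpMeasure hX hreg ht, ?_⟩
  intro Ω' _ P' _ X' g' h' hX' hX0' hreg' μ μ' hμ hμ'
  constructor
  · intro heq
    refine processLaw_eq_of_jumpRate_eq hX hX0 hreg hX' hX0' hreg' fun t ht n π hπ => ?_
    have hμ't := hμ' t ht
    rw [← heq t ht] at hμ't
    exact (hμ t ht).jumpRate_eq hreg hreg' ht hμ't hπ
  · intro hlaw t ht
    exact (hμ t ht).eq_of_jumpRate_eq (hμ' t ht) fun n π hπ =>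
      jumpRate_eq_of_processLaw_eq hX hreg hX' hreg' hlaw ht hπ
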